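/- **Setting.** Let $\mathbf V$ be a semicartesian monoidal category (its unit object $I$ is terminal). Let $\mathbf W$ be a cocomplete category with a closed symmetric monoidal structure $(\otimes,I)$ and a model structure for which $\mathbf W$ is a symmetric monoidal model category (pushout-product axiom) with cofibrant unit, and which is also a simplicial model category, with simplicial copowers $A\odot K$. (No further compatibility between $\otimes$ and the simplicial structure is required.) Let $k$ be a Hausdorff topological ring, and let $\chi:\mathrm{ob}\,\mathbf W\rightharpoonup k$ be a multiplicative Euler characteristic: a partial function, whose domain is called the class of *finite* objects, such that (1) if $A\to B$ is a weak equivalence, then $A$ is finite iff $B$ is, and then $\chi(A)=\chi(B)$; (2) the initial object is finite with $\chi(\emptyset)=0$; (3) if $A,B,C$ are finite, then the homotopy pushout of any span $B\leftarrow A\to C$ is finite, with Euler characteristic $\chi(B)+\chi(C)-\chi(A)$; (4) the unit object is finite with $\chi(I)=1$; (5) if $A,B$ are finite and cofibrant, then $A\otimes B$ is finite and $\chi(A\otimes B)=\chi(A)\chi(B)$. Let $\Sigma:\mathbf V\to\mathbf W$ be a strong monoidal functor taking values in finite objects, and put $\#=\chi\circ\Sigma$. Let $X$ be a $\mathbf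 V$-category with finitely many objects, and let $\Sigma X$ be the $\mathbf W$-category with the same objects and hom-objects $\Sigma(X(x,y))$. Assume that $\Sigma X$ is cofibrant: each $\Sigma X(x,y)$ is cofibrant and each identity map $I\to\Sigma X(x,x)$ is a cofibration. **Magnitude nerve.** Let $\mathbb 1$ be the $\Sigma X$-$\Sigma X$-bimodule $\mathbb 1(x,y)=\Sigma(I)$, with actions induced by the maps to the terminal object $I$ of $\mathbf V$. For objects $x_0,\dots,x_n$ put $$B_{x_0,\dots,x_n}=\Sigma X(x_0,x_1)\otimes\cdots\otimes\Sigma X(x_{n-1},x_n)\otimes\mathbb 1(x_n,x_0).$$ The magnitude nerve is the simplicial object $B_\bullet(\Sigma X,\mathbb 1)$ with $B_n=\coprod_{x_0,\dots,x_n}B_{x_0,\dots,x_n}$, whose inner faces are given by composition, whose outer faces are given by the two actions on $\mathbb 1$, and whose degeneracies insert identities. Its geometric realization is $B(\Sigma X,\mathbb 1)=\int^{n}B_n\odot\Delta^n$. Let $L_{x_0,\dots,x_n}$ be the colimit of the objects $B_{z_0,\dots,z_d}$ over all non-identity degeneracies $(z_0,\dots,z_d)\to(x_0,\dots,x_n)$,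 and put $$\mathrm{wgt}(x_0,\dots,x_n)=\chi(B_{x_0,\dots,x_n})-\chi(L_{x_0,\dots,x_n}).$$ **Convergence.** $X$ has *convergent magnitude Euler characteristic* if (i) $B(\Sigma X,\mathbb 1)$ is finite; (ii) for all objects $x,y$ the series $\sum_{n\ge0}(-1)^n\sum_{x_0=x,\;x_n=y}\mathrm{wgt}(x_0,\dots,x_n)$ converges in $k$, the inner sum being over all $(n+1)$-tuples of objects with first entry $x$ and last entry $y$; (iii) the series $\sum_{n\ge0}(-1)^n\sum_{x_0,\dots,x_n}\mathrm{wgt}(x_0,\dots,x_n)$ converges to $\chi(B(\Sigma X,\mathbb 1))$. **Theorem.** If $X$ has convergent magnitude Euler characteristic, then $X$ has Möbius inversion, i.e. the matrix $Z_X(x,y)=\#(X(x,y))$ is invertible over $k$, and its magnitude, the sum of all entries of $Z_X^{-1}$, equals $\chi(B(\Sigma X,\mathbb 1))$. -/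

import Mathlib

open CategoryTheory MonoidalCategory Limits HomotopicalAlgebra Opposite Filter Topology

universe v u w v₁ u₁ w₁

noncomputable section

namespace MagnitudeHomology

/-! ### Enriched bimodules and the two-sided bar construction -/

/-- A `Y`-`Y`-bimodule for a `W`-category `Y`, i.e. a `W`-functor `Yᵒᵖ ⊗ Y ⥤ W`: a family of objects
`M(x, z)` with a left action of `Y` on the first variable, a right action on the second variable,
both unital and associative and commuting with each other. -/
structure EnrichedBimodule (W : Type u) [Category.{v} W] [MonoidalCategory W]
    (Y : Type w) [EnrichedCategory W Y] where
  obj : Y → Y → W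
  lact (x y z : Y) : (x ⟶[W] y) ⊗ obj y z ⟶ obj x z
  ract (x y z : Y) : obj x y ⊗ (y ⟶[W] z) ⟶ obj x z
  lact_id (x z : Y) : eId W x ▷ obj x z ≫ lact x x z = (λ_ (obj x z)).hom
  lact_comp (x x' y z : Y) :
    eComp W x x' y ▷ obj y z ≫ lact x y z =
      (α_ _ _ _).hom ≫ (x ⟶[W] x') ◁ lact x' y z ≫ lact x x' z
  ract_id (x z : Y) : obj x z ◁ eId W z ≫ ract x z z = (ρ_ (obj x z)).hom
  ract_comp (x y z z' : Y) :
    obj x y ◁ eComp W y z z' ≫ ract x y z' =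
      (α_ _ _ _).inv ≫ ract x y z ▷ (z ⟶[W] z') ≫ ract x z z'
  lact_ract (x y z z' : Y) :
    lact x y z ▷ (z ⟶[W] z') ≫ ract x z z' =
      (α_ _ _ _).hom ≫ (x ⟶[W] y) ◁ ract y z z' ≫ lact x y z'

namespace EnrichedBimodule
variable {W : Type u} [Category.{v} W] [MonoidalCategory W]
    {Y : Type w} [EnrichedCategory W Y] (M : EnrichedBimodule W Y)

/-! For a list `y₀, …, yₙ` of objects of `Y` we consider the right-nested tensor products
`seg i = Y(yᵢ, yᵢ₊₁) ⊗ (Y(yᵢ₊₁, yᵢ₊₂) ⊗ (⋯ ⊗ M(yₙ, z)))`, together with the maps relating them. -/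

/-- `seg n y z i = Y(yᵢ, yᵢ₊₁) ⊗ (⋯ ⊗ (Y(yₙ₋₁, yₙ) ⊗ M(yₙ, z)))`. -/
def seg : (n : ℕ) → (Fin (n + 1) → Y) → Y → Fin (n + 1) → W
  | 0, y, z, _ => M.obj (y 0) z
  | n + 1, y, z, i =>
      Fin.cases ((y 0 ⟶[W] y (Fin.succ 0)) ⊗ seg n (fun j => y j.succ) z 0)
        (fun i => seg n (fun j => y j.succ) z i) i

/-- Insertion of an identity: `seg i ⟶ Y(yᵢ, yᵢ) ⊗ seg i`. -/
def unitIns {n : ℕ} (y : Fin (n + 1) → Y) (z : Y) (i : Fin (n + 1)) :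
    M.seg n y z i ⟶ (y i ⟶[W] y i) ⊗ M.seg n y z i :=
  (λ_ _).inv ≫ eId W (y i) ▷ _

/-- Composition of the tensor factors between `i` and `j`: the map `seg i ⟶ Y(yᵢ, yⱼ) ⊗ seg j` for
`i ≤ j` (the insertion of an identity if `i = j`). -/
def split : (n : ℕ) → (y : Fin (n + 1) → Y) → (z : Y) → (i j : Fin (n + 1)) → i ≤ j →
    (M.seg n y z i ⟶ (y i ⟶[W] y j) ⊗ M.seg n y z j)
  | 0, y, z, i, j, _ =>
      Fin.cases (motive := fun i => M.seg 0 y z i ⟶ (y i ⟶[W] y j) ⊗ M.seg 0 y z j)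
        (Fin.cases (motive := fun j => M.seg 0 y z 0 ⟶ (y 0 ⟶[W] y j) ⊗ M.seg 0 y z j)
          (M.unitIns y z 0) (fun j => j.elim0) j) (fun i => i.elim0) i
  | n + 1, y, z, i, j, h =>
      Fin.cases (motive := fun i => i ≤ j → (M.seg (n + 1) y z i ⟶ (y i ⟶[W] y j) ⊗ M.seg (n + 1) y z j))
        (fun _ => Fin.cases (motive := fun j => M.seg (n + 1) y z 0 ⟶ (y 0 ⟶[W] y j) ⊗ M.seg (n + 1) y z j)
          (M.unitIns y z 0)
          (fun j => (y 0 ⟶[W] y (Fin.succ 0)) ◁ split n (fun j => y j.succ) z 0 j (Fin.zero_le j) ≫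
            (α_ _ _ _).inv ≫ eComp W (y 0) (y (Fin.succ 0)) (y j.succ) ▷ _) j)
        (fun i => Fin.cases (motive := fun j => i.succ ≤ j → (M.seg (n + 1) y z i.succ ⟶ (y i.succ ⟶[W] y j) ⊗ M.seg (n + 1) y z j))
          (fun h => absurd h (by simp))
          (fun j h => split n (fun j => y j.succ) z i j (Fin.succ_le_succ_iff.1 h)) j) i h

/-- The left action of all tensor factors on `M`: the map `seg i ⟶ M(yᵢ, z)`. -/
def act : (n : ℕ) → (y : Fin (n + 1) → Y) → (z : Y) → (i : Fin (n + 1)) →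
    (M.seg n y z i ⟶ M.obj (y i) z)
  | 0, y, z, i => Fin.cases (motive := fun i => M.seg 0 y z i ⟶ M.obj (y i) z)
      (𝟙 _) (fun i => i.elim0) i
  | n + 1, y, z, i => Fin.cases (motive := fun i => M.seg (n + 1) y z i ⟶ M.obj (y i) z)
      ((y 0 ⟶[W] y (Fin.succ 0)) ◁ act n (fun j => y j.succ) z 0 ≫ M.lact (y 0) (y (Fin.succ 0)) z)
      (fun i => act n (fun j => y j.succ) z i) i

/-- The right action on the last tensor factor `M(yₙ, z)`: the map
`seg i ⊗ Y(z, z') ⟶ seg i` with `z` replaced by `z'`. -/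
def rmul (z z' : Y) : (n : ℕ) → (y : Fin (n + 1) → Y) → (i : Fin (n + 1)) →
    (M.seg n y z i ⊗ (z ⟶[W] z') ⟶ M.seg n y z' i)
  | 0, y, _ => M.ract (y 0) z z'
  | n + 1, y, i => Fin.cases (motive := fun i => M.seg (n + 1) y z i ⊗ (z ⟶[W] z') ⟶ M.seg (n + 1) y z' i)
      ((α_ _ _ _).hom ≫ (y 0 ⟶[W] y (Fin.succ 0)) ◁ rmul z z' n (fun j => y j.succ) 0)
      (fun i => rmul z z' n (fun j => y j.succ) i) i

/-- For a monotone `φ : [m] → [n]` and `w = y ∘ φ`, the map from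
`seg (φ j) = Y(y_{φ j}, ·) ⊗ ⋯ ⊗ M(yₙ, z)` to `Y(wⱼ, wⱼ₊₁) ⊗ ⋯ ⊗ Y(wₘ₋₁, wₘ) ⊗ M(wₘ, z)` which
composes the factors between `φ k` and `φ (k + 1)` (inserting an identity when these agree), and lets
the factors after `φ m` act on `M` from the left. -/
def pull {n : ℕ} (y : Fin (n + 1) → Y) (z : Y) : (m : ℕ) → (φ : Fin (m + 1) → Fin (n + 1)) →
    Monotone φ → (j : Fin (m + 1)) → (M.seg n y z (φ j) ⟶ M.seg m (fun k => y (φ k)) z j)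
  | 0, φ, _, j => Fin.cases (motive := fun j => M.seg n y z (φ j) ⟶ M.seg 0 (fun k => y (φ k)) z j)
      (M.act n y z (φ 0)) (fun i => i.elim0) j
  | m + 1, φ, h, j =>
      Fin.cases (motive := fun j => M.seg n y z (φ j) ⟶ M.seg (m + 1) (fun k => y (φ k)) z j)
      (M.split n y z (φ 0) (φ (Fin.succ 0)) (h (Fin.zero_le _)) ≫
        (y (φ 0) ⟶[W] y (φ (Fin.succ 0))) ◁
          pull y z m (fun k => φ k.succ) (fun _ _ hab => h (Fin.succ_le_succ_iff.2 hab)) 0)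
      (fun j => pull y z m (fun k => φ k.succ) (fun _ _ hab => h (Fin.succ_le_succ_iff.2 hab)) j) j

theorem split_self (n : ℕ) (y : Fin (n + 1) → Y) (z : Y) (i : Fin (n + 1)) (h : i ≤ i) :
    M.split n y z i i h = M.unitIns y z i := by
  induction n with
  | zero => induction i using Fin.cases with
    | zero => rfl
    | succ i => exact i.elim0
  | succ n ih => induction i using Fin.cases with
    | zero => rfl
    | succ i => exact ih (fun j => y j.succ) i _

theorem unitIns_split_aux (A B : Y) (P S : W) (f : S ⟶ (A ⟶[W] B) ⊗ P) :
    ((λ_ S).inv ≫ eId W A ▷ S) ≫ (A ⟶[W] A) ◁ f ≫ (α_ _ _ _).inv ≫ eComp W A A B ▷ P = f := by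
  rw [Category.assoc, ← whisker_exchange_assoc, associator_inv_naturality_left_assoc,
    ← comp_whiskerRight, ← leftUnitor_inv_naturality_assoc, leftUnitor_tensor_inv,
    Category.assoc, Iso.hom_inv_id_assoc, ← comp_whiskerRight, e_id_comp]
  simp

theorem split_split_aux (A B C D : Y) (P Q S : W) (f : S ⟶ (B ⟶[W] C) ⊗ P)
    (g : P ⟶ (C ⟶[W] D) ⊗ Q) :
    ((A ⟶[W] B) ◁ f ≫ (α_ _ _ _).inv ≫ eComp W A B C ▷ P) ≫
        (A ⟶[W] C) ◁ g ≫ (α_ _ _ _).inv ≫ eComp W A C D ▷ Q =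
      (A ⟶[W] B) ◁ (f ≫ (B ⟶[W] C) ◁ g ≫ (α_ _ _ _).inv ≫ eComp W B C D ▷ Q) ≫
        (α_ _ _ _).inv ≫ eComp W A B D ▷ Q := by
  simp only [whiskerLeft_comp, Category.assoc]
  rw [← whisker_exchange_assoc, associator_inv_naturality_left_assoc, ← comp_whiskerRight,
    ← e_assoc' W A B C D]
  monoidal

theorem split_split (n : ℕ) (y : Fin (n + 1) → Y) (z : Y) (i j k : Fin (n + 1))
    (hij : i ≤ j) (hjk : j ≤ k) :
    M.split n y z i j hij ≫ (y i ⟶[W] y j) ◁ M.split n y z j k hjk ≫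
      (α_ _ _ _).inv ≫ eComp W (y i) (y j) (y k) ▷ _ = M.split n y z i k (hij.trans hjk) := by
  induction n with
  | zero =>
    obtain rfl := Fin.fin_one_eq_zero i
    obtain rfl := Fin.fin_one_eq_zero j
    obtain rfl := Fin.fin_one_eq_zero k
    exact unitIns_split_aux _ _ _ _ _
  | succ n ih =>
    induction i using Fin.cases with
    | zero =>
      induction j using Fin.cases with
      | zero => exact unitIns_split_aux _ _ _ _ _
      | succ j =>
        induction k using Fin.cases with
        | zero => exact absurd hjk (by simp)
        | succ k =>
          have := ih (fun j => y j.succ) 0 j k (Fin.zero_le _) (Fin.succ_le_succ_iff.1 hjk)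
          refine (split_split_aux (y 0) (y (Fin.succ 0)) (y j.succ) (y k.succ) _ _ _
            (M.split n (fun j => y j.succ) z 0 j (Fin.zero_le j))
            (M.split n (fun j => y j.succ) z j k (Fin.succ_le_succ_iff.1 hjk))).trans ?_
          exact congrArg (fun f => (y 0 ⟶[W] y (Fin.succ 0)) ◁ f ≫ (α_ _ _ _).inv ≫
            eComp W (y 0) (y (Fin.succ 0)) (y k.succ) ▷ _) this
    | succ i =>
      induction j using Fin.cases with
      | zero => exact absurd hij (by simp)
      | succ j =>
        induction k using Fin.cases with
        | zero => exact absurd hjk (by simp)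
        | succ k =>
          exact ih (fun j => y j.succ) i j k (Fin.succ_le_succ_iff.1 hij)
            (Fin.succ_le_succ_iff.1 hjk)

theorem unitIns_act_aux (A B : Y) (S : W) (f : S ⟶ M.obj A B) :
    ((λ_ S).inv ≫ eId W A ▷ S) ≫ (A ⟶[W] A) ◁ f ≫ M.lact A A B = f := by
  rw [Category.assoc, ← whisker_exchange_assoc, M.lact_id]
  simp

theorem split_act_aux (A B C D : Y) (P S : W) (f : S ⟶ (B ⟶[W] C) ⊗ P) (g : P ⟶ M.obj C D) :
    ((A ⟶[W] B) ◁ f ≫ (α_ _ _ _).inv ≫ eComp W A B C ▷ P) ≫ (A ⟶[W] C) ◁ g ≫ M.lact A C D =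
      (A ⟶[W] B) ◁ (f ≫ (B ⟶[W] C) ◁ g ≫ M.lact B C D) ≫ M.lact A B D := by
  simp only [whiskerLeft_comp, Category.assoc]
  rw [← whisker_exchange_assoc, M.lact_comp]
  simp

theorem split_act (n : ℕ) (y : Fin (n + 1) → Y) (z : Y) (i j : Fin (n + 1)) (hij : i ≤ j) :
    M.split n y z i j hij ≫ (y i ⟶[W] y j) ◁ M.act n y z j ≫ M.lact (y i) (y j) z =
      M.act n y z i := by
  induction n with
  | zero =>
    obtain rfl := Fin.fin_one_eq_zero i
    obtain rfl := Fin.fin_one_eq_zero j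
    exact unitIns_act_aux _ _ _ _ _
  | succ n ih =>
    induction i using Fin.cases with
    | zero =>
      induction j using Fin.cases with
      | zero => exact unitIns_act_aux _ _ _ _ _
      | succ j =>
        refine (M.split_act_aux (y 0) (y (Fin.succ 0)) (y j.succ) z _ _
            (M.split n (fun j => y j.succ) z 0 j (Fin.zero_le j))
            (M.act n (fun j => y j.succ) z j)).trans ?_
        exact congrArg (fun f => (y 0 ⟶[W] y (Fin.succ 0)) ◁ f ≫ M.lact (y 0) (y (Fin.succ 0)) z)
          (ih (fun j => y j.succ) 0 j (Fin.zero_le j))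
    | succ i =>
      induction j using Fin.cases with
      | zero => exact absurd hij (by simp)
      | succ j => exact ih (fun j => y j.succ) i j (Fin.succ_le_succ_iff.1 hij)

theorem rmul_unitIns_aux (A : Y) (S S' C : W) (r : S ⊗ C ⟶ S') :
    r ≫ (λ_ S').inv ≫ eId W A ▷ S' =
      ((λ_ S).inv ≫ eId W A ▷ S) ▷ C ≫ (α_ _ _ _).hom ≫ (A ⟶[W] A) ◁ r := by
  rw [leftUnitor_inv_naturality_assoc, whisker_exchange]
  monoidal

theorem rmul_split_aux (A B D : Y) (C P P' S S' : W) (f : S ⟶ (B ⟶[W] D) ⊗ P)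
    (f' : S' ⟶ (B ⟶[W] D) ⊗ P') (r : S ⊗ C ⟶ S') (q : P ⊗ C ⟶ P')
    (h : r ≫ f' = f ▷ C ≫ (α_ _ _ _).hom ≫ (B ⟶[W] D) ◁ q) :
    ((α_ _ _ _).hom ≫ (A ⟶[W] B) ◁ r) ≫ (A ⟶[W] B) ◁ f' ≫ (α_ _ _ _).inv ≫ eComp W A B D ▷ P' =
      ((A ⟶[W] B) ◁ f ≫ (α_ _ _ _).inv ≫ eComp W A B D ▷ P) ▷ C ≫ (α_ _ _ _).hom ≫
        (A ⟶[W] D) ◁ q := by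
  rw [Category.assoc, ← whiskerLeft_comp_assoc, h]
  simp only [whiskerLeft_comp, comp_whiskerRight, Category.assoc]
  rw [associator_naturality_left_assoc, ← whisker_exchange]
  monoidal

theorem rmul_split (z z' : Y) (n : ℕ) (y : Fin (n + 1) → Y) (i j : Fin (n + 1)) (hij : i ≤ j) :
    M.rmul z z' n y i ≫ M.split n y z' i j hij =
      M.split n y z i j hij ▷ (z ⟶[W] z') ≫ (α_ _ _ _).hom ≫
        (y i ⟶[W] y j) ◁ M.rmul z z' n y j := by
  induction n with
  | zero =>
    obtain rfl := Fin.fin_one_eq_zero i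
    obtain rfl := Fin.fin_one_eq_zero j
    exact rmul_unitIns_aux _ _ _ _ _
  | succ n ih =>
    induction i using Fin.cases with
    | zero =>
      induction j using Fin.cases with
      | zero => exact rmul_unitIns_aux _ _ _ _ _
      | succ j =>
        exact rmul_split_aux (y 0) (y (Fin.succ 0)) (y j.succ) _ _ _ _ _ _ _ _ _
          (ih (fun j => y j.succ) 0 j (Fin.zero_le j))
    | succ i =>
      induction j using Fin.cases with
      | zero => exact absurd hij (by simp)
      | succ j => exact ih (fun j => y j.succ) i j (Fin.succ_le_succ_iff.1 hij)

theorem rmul_act (z z' : Y) (n : ℕ) (y : Fin (n + 1) → Y) (i : Fin (n + 1)) :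
    M.rmul z z' n y i ≫ M.act n y z' i = M.act n y z i ▷ (z ⟶[W] z') ≫ M.ract (y i) z z' := by
  induction n with
  | zero =>
    obtain rfl := Fin.fin_one_eq_zero i
    have : ∀ (A B D : Y), M.ract A B D ≫ 𝟙 _ = 𝟙 _ ▷ (B ⟶[W] D) ≫ M.ract A B D := by simp
    exact this (y 0) z z'
  | succ n ih =>
    induction i using Fin.cases with
    | zero =>
      have aux : ∀ (A B : Y) (S S' : W) (r : S ⊗ (z ⟶[W] z') ⟶ S') (a : S ⟶ M.obj B z)
          (a' : S' ⟶ M.obj B z') (_ : r ≫ a' = a ▷ (z ⟶[W] z') ≫ M.ract B z z'),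
          ((α_ _ _ _).hom ≫ (A ⟶[W] B) ◁ r) ≫ (A ⟶[W] B) ◁ a' ≫ M.lact A B z' =
            ((A ⟶[W] B) ◁ a ≫ M.lact A B z) ▷ (z ⟶[W] z') ≫ M.ract A z z' := by
        intro A B S S' r a a' h
        rw [Category.assoc, ← whiskerLeft_comp_assoc, h, comp_whiskerRight, Category.assoc,
          M.lact_ract]
        simp
      exact aux (y 0) (y (Fin.succ 0)) _ _ _ _ _ (ih (fun j => y j.succ) 0)
    | succ i => exact ih (fun j => y j.succ) i

theorem rmul_id (z : Y) (n : ℕ) (y : Fin (n + 1) → Y) (i : Fin (n + 1)) :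
    M.seg n y z i ◁ eId W z ≫ M.rmul z z n y i = (ρ_ _).hom := by
  induction n with
  | zero => exact M.ract_id (y 0) z
  | succ n ih =>
    induction i using Fin.cases with
    | zero =>
      have aux : ∀ (A S : W) (r : S ⊗ (z ⟶[W] z) ⟶ S) (_ : S ◁ eId W z ≫ r = (ρ_ S).hom),
          (A ⊗ S) ◁ eId W z ≫ (α_ _ _ _).hom ≫ A ◁ r = (ρ_ (A ⊗ S)).hom := by
        intro A S r h
        rw [rightUnitor_tensor_hom, ← h]
        simp
      exact aux _ _ _ (ih (fun j => y j.succ) 0)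
    | succ i => exact ih (fun j => y j.succ) i

theorem rmul_rmul (z z' z'' : Y) (n : ℕ) (y : Fin (n + 1) → Y) (i : Fin (n + 1)) :
    M.seg n y z i ◁ eComp W z z' z'' ≫ M.rmul z z'' n y i =
      (α_ _ _ _).inv ≫ M.rmul z z' n y i ▷ (z' ⟶[W] z'') ≫ M.rmul z' z'' n y i := by
  induction n with
  | zero => exact M.ract_comp (y 0) z z' z''
  | succ n ih =>
    induction i using Fin.cases with
    | zero =>
      have aux : ∀ (A S S' S'' : W) (r : S ⊗ (z ⟶[W] z') ⟶ S') (r' : S' ⊗ (z' ⟶[W] z'') ⟶ S'')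
          (r'' : S ⊗ (z ⟶[W] z'') ⟶ S'')
          (_ : S ◁ eComp W z z' z'' ≫ r'' = (α_ _ _ _).inv ≫ r ▷ (z' ⟶[W] z'') ≫ r'),
          (A ⊗ S) ◁ eComp W z z' z'' ≫ (α_ _ _ _).hom ≫ A ◁ r'' = (α_ _ _ _).inv ≫
            ((α_ _ _ _).hom ≫ A ◁ r) ▷ (z' ⟶[W] z'') ≫ (α_ _ _ _).hom ≫ A ◁ r' := by
        intro A S S' S'' r r' r'' h
        rw [tensor_whiskerLeft]
        simp only [Category.assoc, Iso.inv_hom_id_assoc, ← whiskerLeft_comp, h]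
        simp
      exact aux _ _ _ _ _ _ _ (ih (fun j => y j.succ) 0)
    | succ i => exact ih (fun j => y j.succ) i

theorem pull_act {n : ℕ} (y : Fin (n + 1) → Y) (z : Y) (m : ℕ) (φ : Fin (m + 1) → Fin (n + 1))
    (hφ : Monotone φ) (j : Fin (m + 1)) :
    M.pull y z m φ hφ j ≫ M.act m (fun k => y (φ k)) z j = M.act n y z (φ j) := by
  induction m with
  | zero =>
    obtain rfl := Fin.fin_one_eq_zero j
    exact Category.comp_id _
  | succ m ih =>
    induction j using Fin.cases with
    | zero =>
      rw [← M.split_act n y z (φ 0) (φ (Fin.succ 0)) (hφ (Fin.zero_le _))]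
      have := ih (fun k => φ k.succ) (fun _ _ hab => hφ (Fin.succ_le_succ_iff.2 hab)) 0
      rw [← this, whiskerLeft_comp, Category.assoc]
      exact Category.assoc _ _ _
    | succ j => exact ih (fun k => φ k.succ) (fun _ _ hab => hφ (Fin.succ_le_succ_iff.2 hab)) j

theorem pull_rmul {n : ℕ} (y : Fin (n + 1) → Y) (z z' : Y) (m : ℕ)
    (φ : Fin (m + 1) → Fin (n + 1)) (hφ : Monotone φ) (j : Fin (m + 1)) :
    M.pull y z m φ hφ j ▷ (z ⟶[W] z') ≫ M.rmul z z' m (fun k => y (φ k)) j =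
      M.rmul z z' n y (φ j) ≫ M.pull y z' m φ hφ j := by
  induction m with
  | zero =>
    obtain rfl := Fin.fin_one_eq_zero j
    exact (M.rmul_act z z' n y (φ 0)).symm
  | succ m ih =>
    induction j using Fin.cases with
    | zero =>
      have aux : ∀ (A S T P S' T' P' C : W) (f : S ⟶ A ⊗ T) (g : T ⟶ P) (f' : S' ⟶ A ⊗ T')
          (g' : T' ⟶ P') (r : S ⊗ C ⟶ S') (q : T ⊗ C ⟶ T') (p : P ⊗ C ⟶ P')
          (_ : r ≫ f' = f ▷ C ≫ (α_ _ _ _).hom ≫ A ◁ q) (_ : g ▷ C ≫ p = q ≫ g'),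
          (f ≫ A ◁ g) ▷ C ≫ (α_ _ _ _).hom ≫ A ◁ p = r ≫ f' ≫ A ◁ g' := by
        intro A S T P S' T' P' C f g f' g' r q p h h'
        rw [reassoc_of% h, ← whiskerLeft_comp, ← h']
        simp
      exact aux _ _ _ _ _ _ _ _ _ _ _ _ _ _ _
        (M.rmul_split z z' n y (φ 0) (φ (Fin.succ 0)) (hφ (Fin.zero_le _)))
        (ih (fun k => φ k.succ) (fun _ _ hab => hφ (Fin.succ_le_succ_iff.2 hab)) 0)
    | succ j => exact ih (fun k => φ k.succ) (fun _ _ hab => hφ (Fin.succ_le_succ_iff.2 hab)) j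

theorem pull_split {n : ℕ} (y : Fin (n + 1) → Y) (z : Y) (m : ℕ)
    (φ : Fin (m + 1) → Fin (n + 1)) (hφ : Monotone φ) (i j : Fin (m + 1)) (hij : i ≤ j) :
    M.pull y z m φ hφ i ≫ M.split m (fun k => y (φ k)) z i j hij =
      M.split n y z (φ i) (φ j) (hφ hij) ≫ (y (φ i) ⟶[W] y (φ j)) ◁ M.pull y z m φ hφ j := by
  have aux : ∀ (A : Y) (S P : W) (p : S ⟶ P), p ≫ (λ_ P).inv ≫ eId W A ▷ P =
      ((λ_ S).inv ≫ eId W A ▷ S) ≫ (A ⟶[W] A) ◁ p := by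
    intro A S P p
    rw [Category.assoc, ← whisker_exchange, leftUnitor_inv_naturality_assoc]
  induction m with
  | zero =>
    obtain rfl := Fin.fin_one_eq_zero i
    obtain rfl := Fin.fin_one_eq_zero j
    rw [split_self, split_self]
    exact aux _ _ _ _
  | succ m ih =>
    induction i using Fin.cases with
    | zero =>
      induction j using Fin.cases with
      | zero =>
        rw [split_self, split_self]
        exact aux _ _ _ _
      | succ j =>
        have aux2 : ∀ (A B C : Y) (S T P Q R : W) (f : S ⟶ (A ⟶[W] B) ⊗ T) (g : T ⟶ P)
            (h : P ⟶ (B ⟶[W] C) ⊗ Q) (h' : T ⟶ (B ⟶[W] C) ⊗ R) (g' : R ⟶ Q)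
            (_ : g ≫ h = h' ≫ (B ⟶[W] C) ◁ g'),
            (f ≫ (A ⟶[W] B) ◁ g) ≫ (A ⟶[W] B) ◁ h ≫ (α_ _ _ _).inv ≫ eComp W A B C ▷ Q =
              (f ≫ (A ⟶[W] B) ◁ h' ≫ (α_ _ _ _).inv ≫ eComp W A B C ▷ R) ≫
                (A ⟶[W] C) ◁ g' := by
          intro A B C S T P Q R f g h h' g' e
          simp only [Category.assoc]
          rw [← whiskerLeft_comp_assoc, e, ← whisker_exchange]
          simp
        rw [← M.split_split n y z (φ 0) (φ (Fin.succ 0)) (φ j.succ) (hφ (Fin.zero_le _))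
          (hφ (Fin.succ_le_succ_iff.2 (Fin.zero_le _)))]
        exact aux2 _ _ _ _ _ _ _ _ _ _ _ _ _
          (ih (fun k => φ k.succ) (fun _ _ hab => hφ (Fin.succ_le_succ_iff.2 hab)) 0 j
            (Fin.zero_le _))
    | succ i =>
      induction j using Fin.cases with
      | zero => exact absurd hij (by simp)
      | succ j =>
        exact ih (fun k => φ k.succ) (fun _ _ hab => hφ (Fin.succ_le_succ_iff.2 hab)) i j
          (Fin.succ_le_succ_iff.1 hij)

theorem pull_succ {n : ℕ} (y : Fin (n + 2) → Y) (z : Y) (m : ℕ)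
    (φ : Fin (m + 1) → Fin (n + 1)) (hφ : Monotone φ) (hφ' : Monotone fun k => (φ k).succ)
    (j : Fin (m + 1)) :
    M.pull y z m (fun k => (φ k).succ) hφ' j = M.pull (fun k => y k.succ) z m φ hφ j := by
  induction m with
  | zero =>
    obtain rfl := Fin.fin_one_eq_zero j
    rfl
  | succ m ih =>
    induction j using Fin.cases with
    | zero =>
      exact congrArg (fun f => M.split (n + 1) y z (φ 0).succ (φ (Fin.succ 0)).succ
          (hφ' (Fin.zero_le _)) ≫ (y (φ 0).succ ⟶[W] y (φ (Fin.succ 0)).succ) ◁ f)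
        (ih (fun k => φ k.succ) (fun _ _ hab => hφ (Fin.succ_le_succ_iff.2 hab))
          (fun _ _ hab => hφ' (Fin.succ_le_succ_iff.2 hab)) 0)
    | succ j => exact ih (fun k => φ k.succ) (fun _ _ hab => hφ (Fin.succ_le_succ_iff.2 hab)) _ j

theorem pull_id (n : ℕ) (y : Fin (n + 1) → Y) (z : Y) (j : Fin (n + 1)) :
    M.pull y z n (fun k => k) monotone_id j = 𝟙 _ := by
  induction n with
  | zero =>
    obtain rfl := Fin.fin_one_eq_zero j
    rfl
  | succ n ih =>
    have key : ∀ j, M.pull y z n (fun k => k.succ) (fun _ _ hab => Fin.succ_le_succ_iff.2 hab) j =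
        𝟙 _ := fun j => (M.pull_succ y z n (fun k => k) monotone_id _ j).trans
          (ih (fun k => y k.succ) j)
    induction j using Fin.cases with
    | zero =>
      have aux : ∀ (A B : Y) (S : W), ((A ⟶[W] B) ◁ ((λ_ S).inv ≫ eId W B ▷ S) ≫
          (α_ _ _ _).inv ≫ eComp W A B B ▷ S) ≫ (A ⟶[W] B) ◁ 𝟙 S = 𝟙 _ := by
        intro A B S
        have h := e_comp_id W A B
        have h' : (A ⟶[W] B) ◁ ((λ_ S).inv ≫ eId W B ▷ S) ≫ (α_ _ _ _).inv =
            ((ρ_ (A ⟶[W] B)).inv ≫ (A ⟶[W] B) ◁ eId W B) ▷ S := by monoidal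
        rw [whiskerLeft_id, Category.comp_id, reassoc_of% h', ← comp_whiskerRight, Category.assoc,
          h, id_whiskerRight]
      have e : M.split n (fun j => y j.succ) z 0 0 (Fin.zero_le 0) =
        M.unitIns (fun j => y j.succ) z 0 := M.split_self n _ z 0 _
      have h1 : M.split (n + 1) y z 0 (Fin.succ 0) (Fin.zero_le _) =
          (y 0 ⟶[W] y (Fin.succ 0)) ◁ M.unitIns (fun j => y j.succ) z 0 ≫
            (α_ _ _ _).inv ≫ eComp W (y 0) (y (Fin.succ 0)) (y (Fin.succ 0)) ▷ _ :=
        congrArg (fun f => (y 0 ⟶[W] y (Fin.succ 0)) ◁ f ≫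
            (α_ _ _ _).inv ≫ eComp W (y 0) (y (Fin.succ 0)) (y (Fin.succ 0)) ▷ _) e
      change M.split (n + 1) y z 0 (Fin.succ 0) (Fin.zero_le _) ≫ (y 0 ⟶[W] y (Fin.succ 0)) ◁
        M.pull y z n (fun k => k.succ) (fun _ _ hab => Fin.succ_le_succ_iff.2 hab) 0 = _
      rw [key, h1]
      exact aux _ _ _
    | succ j => exact key j

theorem pull_pull {n : ℕ} (y : Fin (n + 1) → Y) (z : Y) {m : ℕ} (φ : Fin (m + 1) → Fin (n + 1))
    (hφ : Monotone φ) (l : ℕ) (ψ : Fin (l + 1) → Fin (m + 1)) (hψ : Monotone ψ)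
    (j : Fin (l + 1)) :
    M.pull y z m φ hφ (ψ j) ≫ M.pull (fun k => y (φ k)) z l ψ hψ j =
      M.pull y z l (fun k => φ (ψ k)) (hφ.comp hψ) j := by
  induction l with
  | zero =>
    obtain rfl := Fin.fin_one_eq_zero j
    exact M.pull_act y z m φ hφ (ψ 0)
  | succ l ih =>
    induction j using Fin.cases with
    | zero =>
      have h1 := M.pull_split y z m φ hφ (ψ 0) (ψ (Fin.succ 0)) (hψ (Fin.zero_le _))
      have h2 := ih (fun k => ψ k.succ) (fun _ _ hab => hψ (Fin.succ_le_succ_iff.2 hab)) 0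
      change M.pull y z m φ hφ (ψ 0) ≫ M.split m (fun k => y (φ k)) z (ψ 0) (ψ (Fin.succ 0)) _ ≫
        (y (φ (ψ 0)) ⟶[W] y (φ (ψ (Fin.succ 0)))) ◁ M.pull (fun k => y (φ k)) z l
          (fun k => ψ k.succ) _ 0 =
        M.split n y z (φ (ψ 0)) (φ (ψ (Fin.succ 0))) _ ≫
          (y (φ (ψ 0)) ⟶[W] y (φ (ψ (Fin.succ 0)))) ◁ M.pull y z l (fun k => φ (ψ k.succ)) _ 0
      rw [reassoc_of% h1, ← whiskerLeft_comp]
      exact congrArg (fun f => M.split n y z (φ (ψ 0)) (φ (ψ (Fin.succ 0))) _ ≫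
          (y (φ (ψ 0)) ⟶[W] y (φ (ψ (Fin.succ 0)))) ◁ f) h2
    | succ j => exact ih (fun k => ψ k.succ) (fun _ _ hab => hψ (Fin.succ_le_succ_iff.2 hab)) j

section Symmetric
variable [SymmetricCategory W]

/-- `B_{y₀, …, yₙ}(Y, M) = Y(y₀, y₁) ⊗ (⋯ ⊗ (Y(yₙ₋₁, yₙ) ⊗ M(yₙ, y₀)))`. -/
abbrev barObj {n : ℕ} (y : Fin (n + 1) → Y) : W := M.seg n y (y 0) 0

/-- For a monotone `φ : [m] → [n]`, the map
`B_{y₀, …, yₙ}(Y, M) ⟶ B_{y_{φ 0}, …, y_{φ m}}(Y, M)`: the factors before `φ 0` are composed, moved to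
the end by the symmetry and act on `M` from the right; the factors between `φ k` and `φ (k + 1)` are
composed (an identity is inserted if `φ k = φ (k + 1)`); the factors after `φ m` act on `M` from the
left. So inner faces compose, outer faces act on `M`, degeneracies insert identities. -/
def barMap {n m : ℕ} (y : Fin (n + 1) → Y) (φ : Fin (m + 1) → Fin (n + 1)) (hφ : Monotone φ) :
    M.barObj y ⟶ M.barObj (fun k => y (φ k)) :=
  M.split n y (y 0) 0 (φ 0) (Fin.zero_le _) ≫ (β_ _ _).hom ≫
    M.rmul (y 0) (y (φ 0)) n y (φ 0) ≫ M.pull y (y (φ 0)) m φ hφ 0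

theorem barMap_id {n : ℕ} (y : Fin (n + 1) → Y) :
    M.barMap y (fun k => k) monotone_id = 𝟙 _ := by
  have h := M.rmul_id (y 0) n y 0
  have h2 := M.pull_id n y (y 0) 0
  have h3 := M.split_self n y (y 0) 0 (Fin.zero_le _)
  have aux : ∀ (A S : W) (e : 𝟙_ W ⟶ A) (r : S ⊗ A ⟶ S) (_ : S ◁ e ≫ r = (ρ_ S).hom),
      ((λ_ S).inv ≫ e ▷ S) ≫ (β_ _ _).hom ≫ r ≫ 𝟙 _ = 𝟙 S := by
    intro A S e r h
    rw [Category.comp_id, Category.assoc, BraidedCategory.braiding_naturality_left_assoc, h]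
    simp
  have key := aux _ _ _ _ h
  rw [← h2] at key
  exact (congrArg (fun f => f ≫ (β_ _ _).hom ≫
    M.rmul (y 0) (y 0) n y 0 ≫ M.pull y (y 0) n (fun k => k) monotone_id 0) h3).trans
    (key.trans h2)

theorem barMap_comp_aux (A B S T : W) (T' T'' : W) (C : W) (r : T ⊗ A ⟶ T')
    (r' : T' ⊗ B ⟶ T'') (r'' : T ⊗ C ⟶ T'') (m : A ⊗ B ⟶ C)
    (hr : T ◁ m ≫ r'' = (α_ _ _ _).inv ≫ r ▷ B ≫ r') (f : S ⟶ B ⊗ T) :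
    A ◁ f ≫ (β_ A (B ⊗ T)).hom ≫ (α_ _ _ _).hom ≫ B ◁ r ≫ (β_ B T').hom ≫ r' =
      A ◁ f ≫ (α_ _ _ _).inv ≫ m ▷ T ≫ (β_ C T).hom ≫ r'' := by
  have e0 := BraidedCategory.braiding_naturality_right B r
  rw [BraidedCategory.braiding_naturality_left_assoc, hr, reassoc_of% e0]
  have e : (β_ A (B ⊗ T)).hom ≫ (α_ _ _ _).hom ≫ (β_ B (T ⊗ A)).hom =
      (α_ _ _ _).inv ≫ (β_ (A ⊗ B) T).hom ≫ (α_ _ _ _).inv := by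
    have yb := BraidedCategory.yang_baxter_assoc A B T (T ◁ (β_ B A).hom ≫ (α_ T A B).inv)
    simp only [BraidedCategory.braiding_tensor_left_hom, BraidedCategory.braiding_tensor_right_hom,
      Category.assoc, Iso.hom_inv_id_assoc]
    rw [yb]
    simp [← whiskerLeft_comp_assoc]
  rw [reassoc_of% e]

theorem barMap_comp {n m l : ℕ} (y : Fin (n + 1) → Y) (φ : Fin (m + 1) → Fin (n + 1))
    (hφ : Monotone φ) (ψ : Fin (l + 1) → Fin (m + 1)) (hψ : Monotone ψ) :
    M.barMap y φ hφ ≫ M.barMap (fun k => y (φ k)) ψ hψ =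
      M.barMap y (fun k => φ (ψ k)) (hφ.comp hψ) := by
  have h1 := M.pull_pull y (y (φ (ψ 0))) φ hφ l ψ hψ 0
  have h2 := M.pull_split y (y (φ 0)) m φ hφ 0 (ψ 0) (Fin.zero_le _)
  have h3 := M.pull_rmul y (y (φ 0)) (y (φ (ψ 0))) m φ hφ (ψ 0)
  have h4 := M.rmul_split (y 0) (y (φ 0)) n y (φ 0) (φ (ψ 0)) (hφ (Fin.zero_le _))
  have h5 := M.rmul_rmul (y 0) (y (φ 0)) (y (φ (ψ 0))) n y (φ (ψ 0))
  have h6 := M.split_split n y (y 0) 0 (φ 0) (φ (ψ 0)) (Fin.zero_le _) (hφ (Fin.zero_le _))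
  have aux : ∀ (A B C S S₁ S₁' S₂ S₂' S₂'' P₁ P₂ P₂'' P₃ : W) (s₁ : S ⟶ A ⊗ S₁)
      (r₁ : S₁ ⊗ A ⟶ S₁') (p₁ : S₁' ⟶ P₁) (s₂ : P₁ ⟶ B ⊗ P₂) (r₂ : P₂ ⊗ B ⟶ P₂'')
      (p₂ : P₂'' ⟶ P₃) (p₁' : S₂' ⟶ P₂) (s' : S₁' ⟶ B ⊗ S₂') (r₂' : S₂' ⊗ B ⟶ S₂'')
      (p₁'' : S₂'' ⟶ P₂'') (s : S₁ ⟶ B ⊗ S₂) (r : S₂ ⊗ A ⟶ S₂') (r'' : S₂ ⊗ C ⟶ S₂'')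
      (c : A ⊗ B ⟶ C) (t : S ⟶ C ⊗ S₂) (p : S₂'' ⟶ P₃) (_ : p₁'' ≫ p₂ = p)
      (_ : p₁ ≫ s₂ = s' ≫ B ◁ p₁') (_ : p₁' ▷ B ≫ r₂ = r₂' ≫ p₁'')
      (_ : r₁ ≫ s' = s ▷ A ≫ (α_ _ _ _).hom ≫ B ◁ r)
      (_ : S₂ ◁ c ≫ r'' = (α_ _ _ _).inv ≫ r ▷ B ≫ r₂')
      (_ : s₁ ≫ A ◁ s ≫ (α_ _ _ _).inv ≫ c ▷ S₂ = t),
      (s₁ ≫ (β_ _ _).hom ≫ r₁ ≫ p₁) ≫ s₂ ≫ (β_ _ _).hom ≫ r₂ ≫ p₂ =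
        t ≫ (β_ _ _).hom ≫ r'' ≫ p := by
    intro A B C S S₁ S₁' S₂ S₂' S₂'' P₁ P₂ P₂'' P₃ s₁ r₁ p₁ s₂ r₂ p₂ p₁' s' r₂' p₁'' s r r'' c t
      p h1 h2 h3 h4 h5 h6
    have h7 := barMap_comp_aux A B S₁ S₂ S₂' S₂'' C r r₂' r'' c h5 s
    simp only [Category.assoc]
    rw [← h1, ← h6, reassoc_of% h2, BraidedCategory.braiding_naturality_right_assoc,
      reassoc_of% h3, reassoc_of% h4, ← BraidedCategory.braiding_naturality_right_assoc]
    simp only [Category.assoc]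
    have h8 := congrArg (fun g => s₁ ≫ g ≫ p₁'' ≫ p₂) h7
    simpa only [Category.assoc] using h8
  exact aux _ _ _ _ _ _ _ _ _ _ _ _ _ _ _ _ _ _ _ _ _ _ _ _ _ _ _ _ _ h1 h2 h3 h4 h5 h6

/-- Transport along equal lists of objects. -/
theorem barMap_congr {n m : ℕ} {y y' : Fin (n + 1) → Y} (h : y = y')
    (φ : Fin (m + 1) → Fin (n + 1)) (hφ : Monotone φ) :
    eqToHom (congrArg M.barObj h) ≫ M.barMap y' φ hφ =
      M.barMap y φ hφ ≫ eqToHom (congrArg (fun y : Fin (n + 1) → Y => M.barObj fun k => y (φ k)) h) := by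
  subst h
  simp

/-- The two-sided simplicial bar construction `B_•(Y, M)`, with
`B_n(Y, M) = ∐_{y₀, …, yₙ} Y(y₀, y₁) ⊗ ⋯ ⊗ Y(yₙ₋₁, yₙ) ⊗ M(yₙ, y₀)`. -/
def barSimplicial [Finite Y] [HasFiniteCoproducts W] : SimplicialObject W where
  obj n := ∐ fun y : Fin (n.unop.len + 1) → Y => M.barObj y
  map {n m} f := Sigma.desc fun y : Fin (n.unop.len + 1) → Y =>
    M.barMap y (fun k => f.unop.toOrderHom k) f.unop.toOrderHom.monotone ≫
      Sigma.ι (fun y : Fin (m.unop.len + 1) → Y => M.barObj y)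
        (fun k => y (f.unop.toOrderHom k))
  map_id n := by
    refine Sigma.hom_ext _ _ fun y => ?_
    rw [Sigma.ι_desc]
    exact (congrArg (fun g => g ≫ Sigma.ι (fun y : Fin (n.unop.len + 1) → Y => M.barObj y) y)
      (M.barMap_id y)).trans ((Category.id_comp _).trans (Category.comp_id _).symm)
  map_comp {n m l} f g := by
    refine Sigma.hom_ext _ _ fun y => ?_
    rw [Sigma.ι_desc, Sigma.ι_desc_assoc, Category.assoc, Sigma.ι_desc, ← Category.assoc]
    exact congrArg (fun h => h ≫ Sigma.ι (fun y : Fin (l.unop.len + 1) → Y => M.barObj y) _)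
      (M.barMap_comp y _ f.unop.toOrderHom.monotone _ g.unop.toOrderHom.monotone).symm

end Symmetric
end EnrichedBimodule

/-! ### Latching objects of the bar construction over a list of objects -/

/-- The index category of the latching object at `y = (y₀, …, yₙ)`: the degeneracies onto `y`, i.e.
lists `z = (z₀, …, z_d)` with `d < n` and a monotone surjection `σ : [n] → [d]` with `z ∘ σ = y`. -/
structure LatchingIndex {Y : Type w} {n : ℕ} (y : Fin (n + 1) → Y) where
  dim : ℕ
  dim_lt : dim < n
  vertices : Fin (dim + 1) → Y
  degen : Fin (n + 1) →o Fin (dim + 1)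
  surjective : Function.Surjective degen
  fac : ∀ k, vertices (degen k) = y k

namespace LatchingIndex

variable {Y : Type w} {n : ℕ} {y : Fin (n + 1) → Y}

/-- A morphism is a simplicial operator `τ : [d'] → [d]` with `τ ∘ σ' = σ`. -/
@[ext]
structure Hom (a b : LatchingIndex y) where
  toMap : Fin (b.dim + 1) →o Fin (a.dim + 1)
  comm : ∀ k, toMap (b.degen k) = a.degen k

instance : Category.{0} (LatchingIndex y) where
  Hom := Hom
  id a := ⟨OrderHom.id, fun _ => rfl⟩
  comp f g := ⟨f.toMap.comp g.toMap, fun k => (congrArg f.toMap (g.comm k)).trans (f.comm k)⟩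

theorem Hom.vertices_eq {a b : LatchingIndex y} (f : Hom a b) :
    (fun k => a.vertices (f.toMap k)) = b.vertices := by
  funext k
  obtain ⟨k, rfl⟩ := b.surjective k
  rw [f.comm, a.fac, b.fac]

instance : Small.{0} (LatchingIndex y) := by
  refine small_of_injective (β := Σ d : ℕ, (Fin (n + 1) → Fin (d + 1)))
    (f := fun a => ⟨a.dim, a.degen⟩) ?_
  rintro ⟨d, h, v, s, hs, hf⟩ ⟨d', h', v', s', hs', hf'⟩ e
  obtain ⟨rfl, e⟩ := Sigma.mk.inj e
  have e' : s = s' := DFunLike.coe_injective (eq_of_heq e)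
  subst e'
  have : v = v' := by
    funext k
    obtain ⟨k, rfl⟩ := hs k
    rw [hf, hf']
  subst this
  rfl

end LatchingIndex

namespace EnrichedBimodule

variable {W : Type u} [Category.{v} W] [MonoidalCategory W] [SymmetricCategory W]
    {Y : Type w} [EnrichedCategory W Y] (M : EnrichedBimodule W Y)

/-- The diagram of the `B_z(Y, M)` over all degeneracies onto `y`. -/
def latchingDiagram {n : ℕ} (y : Fin (n + 1) → Y) : LatchingIndex y ⥤ W where
  obj a := M.barObj a.vertices
  map {a b} f := M.barMap a.vertices (LatchingIndex.Hom.toMap f) (LatchingIndex.Hom.toMap f).monotone ≫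
    eqToHom (congrArg M.barObj (LatchingIndex.Hom.vertices_eq f))
  map_id a := (Category.comp_id _).trans (M.barMap_id a.vertices)
  map_comp {a b c} f g := by
    have h1 := M.barMap_congr (LatchingIndex.Hom.vertices_eq f) (LatchingIndex.Hom.toMap g)
      (LatchingIndex.Hom.toMap g).monotone
    have h2 := M.barMap_comp a.vertices (LatchingIndex.Hom.toMap f)
      (LatchingIndex.Hom.toMap f).monotone (LatchingIndex.Hom.toMap g)
      (LatchingIndex.Hom.toMap g).monotone
    rw [Category.assoc, reassoc_of% h1, eqToHom_trans, reassoc_of% h2]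
    rfl

/-- The latching object `L_{y₀, …, yₙ} B(Y, M)`. -/
def latchingObj [HasColimits W] {n : ℕ} (y : Fin (n + 1) → Y) : W :=
  haveI : HasColimitsOfSize.{0, 0} W := hasColimitsOfSizeShrink.{0, 0, v, v} W
  haveI : HasColimitsOfShape (LatchingIndex y) W :=
    hasColimitsOfShape_of_essentiallySmall.{0} _ _
  colimit (M.latchingDiagram y)

end EnrichedBimodule

/-! ### Simplicial model categories and geometric realization -/

section Simplicial

variable {W : Type u} [Category.{v} W] [SimplicialCategory W]

open SimplicialCategory

/-- The map of simplicial sets `Map(P, B) ⟶ Map(A, B)^K` induced by `η : K ⟶ Map(A, P)`. -/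
def copowerComparison {A P : W} {K : SSet.{v}} (η : K ⟶ sHom A P) (B : W) :
    sHom P B ⟶ (ihom K).obj (sHom A B) :=
  MonoidalClosed.curry (η ▷ sHom P B ≫ sHomComp A P B)

/-- The map of simplicial sets `Map(B, P) ⟶ Map(B, A)^K` induced by `ε : K ⟶ Map(P, A)`. -/
def powerComparison {A P : W} {K : SSet.{v}} (ε : K ⟶ sHom P A) (B : W) :
    sHom B P ⟶ (ihom K).obj (sHom B A) :=
  MonoidalClosed.curry ((β_ _ _).hom ≫ sHom B P ◁ ε ≫ sHomComp B P A)

end Simplicial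

/-- A simplicial model category: a model category enriched over simplicial sets, with copowers
`A ⊙ K` and powers `A ^ K`, such that for a cofibration `i : A ⟶ B` and a fibration `p : X ⟶ Y`
the map `Map(B, X) ⟶ Map(A, X) ×_{Map(A, Y)} Map(B, Y)` is a Kan fibration, which is trivial if `i`
or `p` is a weak equivalence. The class of Kan fibrations is `J.rlp` (right lifting property against
the horn inclusions), that of trivial Kan fibrations is `I.rlp` (boundary inclusions). -/
class SimplicialModelCategory (W : Type u) [Category.{v} W] [ModelCategory W]
    [SimplicialCategory W] where
  /-- The copower bifunctor `(A, K) ↦ A ⊙ K`. -/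
  copower : W ⥤ SSet.{v} ⥤ W
  /-- The universal map `K ⟶ Map(A, A ⊙ K)`. -/
  copowerUnit (A : W) (K : SSet.{v}) : K ⟶ SimplicialCategory.sHom A ((copower.obj A).obj K)
  copowerUnit_naturality_left {A A' : W} (f : A ⟶ A') (K : SSet.{v}) :
    copowerUnit A K ≫ eHomWhiskerLeft SSet.{v} A ((copower.map f).app K) =
      copowerUnit A' K ≫ eHomWhiskerRight SSet.{v} f ((copower.obj A').obj K)
  copowerUnit_naturality_right (A : W) {K K' : SSet.{v}} (g : K ⟶ K') :
    copowerUnit A K ≫ eHomWhiskerLeft SSet.{v} A ((copower.obj A).map g) =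
      g ≫ copowerUnit A K'
  isIso_copowerComparison (A : W) (K : SSet.{v}) (B : W) :
    IsIso (copowerComparison (copowerUnit A K) B)
  exists_power (A : W) (K : SSet.{v}) :
    ∃ (P : W) (ε : K ⟶ SimplicialCategory.sHom P A), ∀ B : W, IsIso (powerComparison ε B)
  kanFibration {A B X Y : W} (i : A ⟶ B) (p : X ⟶ Y) [Cofibration i] [Fibration p]
    (sq : (SimplicialCategory.sHomFunctor W).PullbackObjObj i p) :
    SSet.modelCategoryQuillen.J.rlp sq.π
  trivialKanFibration {A B X Y : W} (i : A ⟶ B) (p : X ⟶ Y) [Cofibration i] [Fibration p]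
    (_ : WeakEquivalence i ∨ WeakEquivalence p)
    (sq : (SimplicialCategory.sHomFunctor W).PullbackObjObj i p) :
    SSet.modelCategoryQuillen.I.rlp sq.π

/-- The geometric realization `|B| = ∫^{n} B_n ⊙ Δ^n` of a simplicial object. -/
def realization {W : Type u} [Category.{v} W] [HasColimits W] [ModelCategory W]
    [SimplicialCategory W] [SimplicialModelCategory W] (B : SimplicialObject W) : W :=
  haveI : HasColimitsOfSize.{0, 0} W := hasColimitsOfSizeShrink.{0, 0, v, v} W
  coend (B ⋙ SimplicialModelCategory.copower ⋙
    (Functor.whiskeringLeft SimplexCategory SSet.{v} W).obj SSet.stdSimplex.{v})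

/-! ### Symmetric monoidal model categories -/

/-- A symmetric monoidal model category (closed symmetric monoidal, with the pushout-product axiom)
whose unit object is cofibrant. -/
class SymmetricMonoidalModelCategory (W : Type u) [Category.{v} W] [ModelCategory W]
    [MonoidalCategory W] [SymmetricCategory W] [MonoidalClosed W] : Prop where
  unit_cofibrant : IsCofibrant (𝟙_ W)
  cofibration {A B C D : W} (f : A ⟶ B) (g : C ⟶ D) [Cofibration f] [Cofibration g]
    (sq : (curriedTensor W).PushoutObjObj f g) : Cofibration sq.ι
  weakEquivalence {A B C D : W} (f : A ⟶ B) (g : C ⟶ D) [Cofibration f] [Cofibration g]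
    (_ : WeakEquivalence f ∨ WeakEquivalence g)
    (sq : (curriedTensor W).PushoutObjObj f g) : WeakEquivalence sq.ι

/-! ### Euler characteristics -/

section Euler

variable {W : Type u} [Category.{v} W] [ModelCategory W]

/-- `D` is a homotopy pushout of the span `B ⟵ A ⟶ C`: it is the pushout of a span
`B' ⟵ A' ⟶ C'` of cofibrant objects, one leg of which is a cofibration, that maps to `B ⟵ A ⟶ C`
by an objectwise weak equivalence. -/
def IsHomotopyPushout {A B C : W} (f : A ⟶ B) (g : A ⟶ C) (D : W) : Prop :=
  ∃ (A' B' C' : W) (f' : A' ⟶ B') (g' : A' ⟶ C') (a : A' ⟶ A) (b : B' ⟶ B) (c : C' ⟶ C)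
    (h : B' ⟶ D) (k : C' ⟶ D),
    IsCofibrant A' ∧ IsCofibrant B' ∧ IsCofibrant C' ∧ Cofibration f' ∧
    WeakEquivalence a ∧ WeakEquivalence b ∧ WeakEquivalence c ∧
    f' ≫ b = a ≫ f ∧ g' ≫ c = a ≫ g ∧ IsPushout f' g' h k

variable (W)

/-- An Euler characteristic on a model category: a partial function on objects, given by its domain
`IsFinite` and its values `val` (the values outside the domain carry no meaning, and no axiom
mentions them). -/
structure EulerCharacteristic (k : Type w) [AddCommGroup k] where
  IsFinite : W → Prop
  val : W → k
  isFinite_iff {A B : W} (f : A ⟶ B) (_ : WeakEquivalence f) : IsFinite A ↔ IsFinite B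
  val_eq {A B : W} (f : A ⟶ B) (_ : WeakEquivalence f) (_ : IsFinite A) : val A = val B
  isFinite_initial : IsFinite (⊥_ W)
  val_initial : val (⊥_ W) = 0
  isFinite_pushout {A B C D : W} (f : A ⟶ B) (g : A ⟶ C) (_ : IsHomotopyPushout f g D)
    (_ : IsFinite A) (_ : IsFinite B) (_ : IsFinite C) : IsFinite D
  val_pushout {A B C D : W} (f : A ⟶ B) (g : A ⟶ C) (_ : IsHomotopyPushout f g D)
    (_ : IsFinite A) (_ : IsFinite B) (_ : IsFinite C) : val D = val B + val C - val A

/-- A multiplicative Euler characteristic on a monoidal model category. -/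
structure MultiplicativeEulerCharacteristic [MonoidalCategory W] (k : Type w) [Ring k]
    extends EulerCharacteristic W k where
  isFinite_unit : IsFinite (𝟙_ W)
  val_unit : val (𝟙_ W) = 1
  isFinite_tensor {A B : W} (_ : IsFinite A) (_ : IsFinite B) (_ : IsCofibrant A)
    (_ : IsCofibrant B) : IsFinite (A ⊗ B)
  val_tensor {A B : W} (_ : IsFinite A) (_ : IsFinite B) (_ : IsCofibrant A)
    (_ : IsCofibrant B) : val (A ⊗ B) = val A * val B

/-- A `W`-category is cofibrant if its hom-objects are cofibrant and its identities `𝟙 ⟶ Y(y, y)`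
are cofibrations. -/
structure IsCofibrantEnriched [MonoidalCategory W] (Y : Type w) [EnrichedCategory W Y] : Prop where
  hom (x y : Y) : IsCofibrant (x ⟶[W] y)
  id (y : Y) : Cofibration (eId W y)

end Euler

/-! ### Magnitude -/

section Magnitude

variable {V : Type u} [Category.{v} V] [MonoidalCategory V] {k : Type w₁} [Ring k]

/-- The zeta matrix `Z_X(x, y) = #(X(x, y))` with respect to `# : ob V → k`. -/
def zetaMatrix (size : V → k) (X : Type w) [EnrichedCategory V X] : Matrix X X k :=
  Matrix.of fun x y => size (x ⟶[V] y)

/-- `X` has Möbius inversion if its zeta matrix is invertible. -/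
def HasMobiusInversion (size : V → k) (X : Type w) [EnrichedCategory V X] [Fintype X]
    [DecidableEq X] : Prop :=
  IsUnit (zetaMatrix size X)

/-- The magnitude of `X`: the sum of all entries of the inverse of the zeta matrix. -/
def magnitude (size : V → k) (X : Type w) [EnrichedCategory V X] [Fintype X]
    [DecidableEq X] (h : HasMobiusInversion size X) : k :=
  ∑ x : X, ∑ y : X, (↑(IsUnit.unit h)⁻¹ : Matrix X X k) x y

end Magnitude

/-! ### The magnitude nerve -/

section Nerve

variable {V : Type u₁} [Category.{v₁} V] [SemiCartesianMonoidalCategory V]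
  {W : Type u} [Category.{v} W] [MonoidalCategory W]

section

variable (S : V ⥤ W) [S.LaxMonoidal]

open Functor.LaxMonoidal SemiCartesianMonoidalCategory

/-- The action of `S A` on `S 1`, where `1` is the unit (and terminal object). -/
def unitLact (A : V) : S.obj A ⊗ S.obj (𝟙_ V) ⟶ S.obj (𝟙_ V) := μ S A (𝟙_ V) ≫ S.map (toUnit _)

/-- The right action of `S A` on `S 1`, where `1` is the unit (and terminal object). -/
def unitRact (A : V) : S.obj (𝟙_ V) ⊗ S.obj A ⟶ S.obj (𝟙_ V) := μ S (𝟙_ V) A ≫ S.map (toUnit _)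

theorem unitLact_id {A : V} (e : 𝟙_ V ⟶ A) :
    (ε S ≫ S.map e) ▷ S.obj (𝟙_ V) ≫ unitLact S A = (λ_ _).hom := by
  rw [unitLact, left_unitality, comp_whiskerRight, Category.assoc, μ_natural_left_assoc,
    ← S.map_comp, toUnit_unique (e ▷ 𝟙_ V ≫ toUnit _) (λ_ _).hom]

theorem unitRact_id {A : V} (e : 𝟙_ V ⟶ A) :
    S.obj (𝟙_ V) ◁ (ε S ≫ S.map e) ≫ unitRact S A = (ρ_ _).hom := by
  rw [unitRact, right_unitality, whiskerLeft_comp, Category.assoc, μ_natural_right_assoc,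
    ← S.map_comp, toUnit_unique (𝟙_ V ◁ e ≫ toUnit _) (ρ_ _).hom]

theorem unitLact_comp {A B C : V} (m : A ⊗ B ⟶ C) :
    (μ S A B ≫ S.map m) ▷ S.obj (𝟙_ V) ≫ unitLact S C =
      (α_ _ _ _).hom ≫ S.obj A ◁ unitLact S B ≫ unitLact S A := by
  simp only [unitLact, comp_whiskerRight, whiskerLeft_comp, Category.assoc, μ_natural_left_assoc,
    μ_natural_right_assoc, ← S.map_comp, ← associativity_assoc]
  simp only [comp_toUnit]

theorem unitRact_comp {A B C : V} (m : A ⊗ B ⟶ C) :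
    S.obj (𝟙_ V) ◁ (μ S A B ≫ S.map m) ≫ unitRact S C =
      (α_ _ _ _).inv ≫ unitRact S A ▷ S.obj B ≫ unitRact S B := by
  rw [Iso.eq_inv_comp]
  simp only [unitRact, comp_whiskerRight, whiskerLeft_comp, Category.assoc, μ_natural_left_assoc,
    μ_natural_right_assoc, ← S.map_comp, ← associativity_assoc]
  simp only [comp_toUnit]

theorem unitLact_unitRact (A B : V) :
    unitLact S A ▷ S.obj B ≫ unitRact S B =
      (α_ _ _ _).hom ≫ S.obj A ◁ unitRact S B ≫ unitLact S A := by
  simp only [unitLact, unitRact, comp_whiskerRight, whiskerLeft_comp, Category.assoc,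
    μ_natural_left_assoc, μ_natural_right_assoc, ← S.map_comp, ← associativity_assoc]
  simp only [comp_toUnit]

/-- The `S X`-`S X`-bimodule `𝟙`: the image under `S` of the bimodule that is constant at the unit
object of `V`, on which `X` acts through the maps to the terminal object. -/
def unitBimodule (X : Type w) [EnrichedCategory V X] :
    EnrichedBimodule W (TransportEnrichment S X) where
  obj _ _ := S.obj (𝟙_ V)
  lact x y _ := unitLact S (EnrichedCategory.Hom (V := V) (C := X) x y)
  ract _ y z := unitRact S (EnrichedCategory.Hom (V := V) (C := X) y z)
  lact_id x _ := unitLact_id S (eId V (C := X) x)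
  lact_comp x x' y _ := unitLact_comp S (eComp V (C := X) x x' y)
  ract_id _ z := unitRact_id S (eId V (C := X) z)
  ract_comp _ y z z' := unitRact_comp S (eComp V (C := X) y z z')
  lact_ract x y z z' := unitLact_unitRact S (EnrichedCategory.Hom (V := V) (C := X) x y)
    (EnrichedCategory.Hom (V := V) (C := X) z z')

end

variable [SymmetricCategory W] [HasColimits W] [ModelCategory W]
  (S : V ⥤ W) [S.Monoidal]

instance (X : Type w) [Finite X] : Finite (TransportEnrichment S X) := inferInstanceAs (Finite X)

/-- The realized magnitude nerve `B(S X, 𝟙)`, the geometric realization of the magnitude nerve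
`B_•(S X, 𝟙)`. -/
def realizedMagnitudeNerve [SimplicialCategory W] [SimplicialModelCategory W] (X : Type w)
    [EnrichedCategory V X] [Finite X] : W :=
  realization (unitBimodule S X).barSimplicial

variable {k : Type w₁} [Ring k]

/-- The weight `χ(B_{x₀, …, xₙ}(S X, 𝟙)) - χ(L_{x₀, …, xₙ} B(S X, 𝟙))` (meaningful when `S X` is
cofibrant and `S` takes finite values). -/
def wgt (χ : MultiplicativeEulerCharacteristic W k) {X : Type w} [EnrichedCategory V X] {n : ℕ}
    (x : Fin (n + 1) → X) : k :=
  χ.val ((unitBimodule S X).barObj x) - χ.val ((unitBimodule S X).latchingObj x)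

/-- Convergent magnitude Euler characteristic of a `V`-category with finitely many objects. A series
converges if its sequence of partial sums does. -/
structure HasConvergentMagnitudeEulerCharacteristic [SimplicialCategory W]
    [SimplicialModelCategory W] [TopologicalSpace k]
    (χ : MultiplicativeEulerCharacteristic W k) (X : Type w) [EnrichedCategory V X] [Fintype X]
    [DecidableEq X] : Prop where
  isFinite : χ.IsFinite (realizedMagnitudeNerve S X)
  converges (a b : X) : ∃ s : k, Tendsto (fun N : ℕ => ∑ n ∈ Finset.range N, (-1) ^ n *
      ∑ x : Fin (n + 1) → X with x 0 = a ∧ x (Fin.last n) = b, wgt S χ x) atTop (𝓝 s)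
  tendsto_val : Tendsto (fun N : ℕ => ∑ n ∈ Finset.range N, (-1) ^ n *
      ∑ x : Fin (n + 1) → X, wgt S χ x) atTop (𝓝 (χ.val (realizedMagnitudeNerve S X)))

end Nerve

end MagnitudeHomology

end

open MagnitudeHomology

/-! Write Z for the zeta matrix. The heart of the proof is the formula wgt(x₀, …, xₙ) = ∏ (Z(xᵢ,
xᵢ₊₁) - [xᵢ = xᵢ₊₁]), proved in `wgt_eq_cubeWeight`. A non-identity degeneracy onto a tuple repeats
vertices at some of the positions where xᵢ = xᵢ₊₁; on the bar construction this replaces the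
hom-objects at these positions by the unit and inserts identities. So the degeneracies form a cube
without its terminal vertex, and the latching object is the colimit over this punctured cube
(`nonempty_latchingDiagram_iso`, `nonempty_latchingObj_iso`). The map from this colimit to the
terminal vertex is an iterated pushout-product: of the identities 𝟙 ⟶ ΣX(xᵢ, xᵢ₊₁) where xᵢ = xᵢ₊₁,
of ∅ ⟶ ΣX(xᵢ, xᵢ₊₁) elsewhere, and of ∅ ⟶ ΣI at the end. All are cofibrations, and χ(target) -
χ(source) is multiplicative under their pushout-products
(`MultiplicativeEulerCharacteristic.pushoutProduct`, `exists_isColimit_cubeFunctor`), with factors Z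
- 1, Z and 1.

Summing the weights over all paths of length n from a to b gives the entry (a, b) of (Z - 1)ⁿ
(`sum_cubeWeight`). Condition (ii) thus says that the Neumann series ∑ (1 - Z)ⁿ converges entrywise,
and then its sum is the inverse of Z. The series in (iii) adds up all entries; since limits in k are
unique, its limit is the magnitude (`isUnit_and_sum_inverse`). -/

namespace MagnitudeHomology

/-! ### Pushout-products and Euler characteristics -/

section TensorInitial

variable {W : Type u} [Category.{v} W] [MonoidalCategory W] [MonoidalClosed W]

instance preservesColimitsOfShape_tensorLeft (A : W) {J : Type w} [Category.{w₁} J] :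
    PreservesColimitsOfShape J (tensorLeft A) :=
  (ihom.adjunction A).leftAdjoint_preservesColimits.preservesColimitsOfShape

/-- Tensoring with an object preserves initial objects. -/
noncomputable def isInitialTensor (A : W) {E : W} (hE : IsInitial E) : IsInitial (A ⊗ E) :=
  IsInitial.isInitialObj (tensorLeft A) E hE

/-- Tensoring with an object preserves initial objects. -/
noncomputable def isInitialTensorRight [BraidedCategory W] (A : W) {E : W} (hE : IsInitial E) :
    IsInitial (E ⊗ A) :=
  (isInitialTensor A hE).ofIso (β_ A E)

end TensorInitial

section EulerCharacteristic

variable {W : Type u} [Category.{v} W] [ModelCategory W]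

theorem isCofibrant_of_iso {A B : W} (e : A ≅ B) [IsCofibrant A] : IsCofibrant B :=
  isCofibrant_of_cofibration e.hom

theorem EulerCharacteristic.isFinite_iff_of_iso {k : Type w} [AddCommGroup k]
    (χ : EulerCharacteristic W k) {A B : W} (e : A ≅ B) : χ.IsFinite A ↔ χ.IsFinite B :=
  χ.isFinite_iff e.hom inferInstance

theorem EulerCharacteristic.val_eq_of_iso {k : Type w} [AddCommGroup k]
    (χ : EulerCharacteristic W k) {A B : W} (e : A ≅ B) (hA : χ.IsFinite A) : χ.val A = χ.val B :=
  χ.val_eq e.hom inferInstance hA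

theorem IsHomotopyPushout.of_isPushout {A B C D : W} {f : A ⟶ B} {g : A ⟶ C}
    {h : B ⟶ D} {i : C ⟶ D} [IsCofibrant A] [IsCofibrant C] [Cofibration f]
    (sq : IsPushout f g h i) : IsHomotopyPushout f g D :=
  ⟨A, B, C, f, g, 𝟙 _, 𝟙 _, 𝟙 _, h, i, inferInstance, isCofibrant_of_cofibration f, inferInstance,
    inferInstance, inferInstance, inferInstance, inferInstance, by simp, by simp, sq⟩

end EulerCharacteristic

section PushoutProduct

variable {W : Type u} [Category.{v} W] [ModelCategory W] [MonoidalCategory W] [SymmetricCategory W]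
  [MonoidalClosed W] [SymmetricMonoidalModelCategory W]

/-- This is the pushout-product of ∅ ⟶ A with g: tensoring with ∅ gives initial objects, so the
pushout is A ⊗ C and the induced map is A ◁ g. -/
theorem cofibration_whiskerLeft (A : W) [IsCofibrant A] {C D : W} (g : C ⟶ D) [Cofibration g] :
    Cofibration (A ◁ g) := by
  have hC : IsInitial ((⊥_ W) ⊗ C) := isInitialTensorRight C initialIsInitial
  have hD : IsInitial ((⊥_ W) ⊗ D) := isInitialTensorRight D initialIsInitial
  have : IsIso ((⊥_ W) ◁ g) := by
    rw [hC.hom_ext ((⊥_ W) ◁ g) (hC.uniqueUpToIso hD).hom]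
    infer_instance
  exact SymmetricMonoidalModelCategory.cofibration (initial.to A) g
    { pt := A ⊗ C
      inl := 𝟙 _
      inr := hD.to _
      isPushout := by
        have : IsIso (((curriedTensor W).obj (⊥_ W)).map g) := this
        exact IsPushout.of_vert_isIso ⟨hC.hom_ext _ _⟩
      ι := A ◁ g
      inl_ι := Category.id_comp _
      inr_ι := hD.hom_ext _ _ }

theorem isCofibrant_tensor (A L : W) [IsCofibrant A] [IsCofibrant L] : IsCofibrant (A ⊗ L) :=
  (isCofibrant_iff_of_isInitial (A ◁ initial.to L) (isInitialTensor A initialIsInitial)).2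
    (cofibration_whiskerLeft A _)

variable {k : Type w} [Ring k] (χ : MultiplicativeEulerCharacteristic W k)

/-- The pushout-product of two cofibrations with cofibrant finite domains and finite codomains:
the Euler characteristic of the "cofibre" is multiplicative. -/
theorem MultiplicativeEulerCharacteristic.pushoutProduct {A B L F P : W} (f : A ⟶ B) (g : L ⟶ F)
    [IsCofibrant A] [IsCofibrant L] [Cofibration f] [Cofibration g]
    (hA : χ.IsFinite A) (hB : χ.IsFinite B) (hL : χ.IsFinite L) (hF : χ.IsFinite F)
    {inl : B ⊗ L ⟶ P} {inr : A ⊗ F ⟶ P} (sq : IsPushout (f ▷ L) (A ◁ g) inl inr)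
    (u : P ⟶ B ⊗ F) (hl : inl ≫ u = B ◁ g) (hr : inr ≫ u = f ▷ F) :
    Cofibration u ∧ IsCofibrant P ∧ χ.IsFinite P ∧
      χ.val (B ⊗ F) - χ.val P = (χ.val B - χ.val A) * (χ.val F - χ.val L) := by
  have : IsCofibrant B := isCofibrant_of_cofibration f
  have : IsCofibrant F := isCofibrant_of_cofibration g
  have : IsCofibrant (A ⊗ L) := isCofibrant_tensor A L
  have : IsCofibrant (B ⊗ L) := isCofibrant_tensor B L
  have : Cofibration (A ◁ g) := cofibration_whiskerLeft A g
  -- The leg known to be a cofibration is A ◁ g, so the square is flipped to put it first.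
  have hpo := IsHomotopyPushout.of_isPushout sq.flip
  have hAL := χ.isFinite_tensor hA hL inferInstance inferInstance
  have hAF := χ.isFinite_tensor hA hF inferInstance inferInstance
  have hBL := χ.isFinite_tensor hB hL inferInstance inferInstance
  have hinl : Cofibration inl := by
    rw [cofibration_iff]
    exact MorphismProperty.of_isPushout sq ((cofibration_iff _).1 inferInstance)
  refine ⟨SymmetricMonoidalModelCategory.cofibration f g
    { pt := P, inl := inl, inr := inr, isPushout := sq, ι := u, inl_ι := hl, inr_ι := hr },
    isCofibrant_of_cofibration inl, χ.isFinite_pushout _ _ hpo hAL hAF hBL, ?_⟩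
  rw [χ.val_pushout _ _ hpo hAL hAF hBL, χ.val_tensor hA hL inferInstance inferInstance,
    χ.val_tensor hA hF inferInstance inferInstance, χ.val_tensor hB hL inferInstance inferInstance,
    χ.val_tensor hB hF inferInstance inferInstance]
  -- With χ(P) = χ(A)χ(F) + χ(B)χ(L) - χ(A)χ(L), the difference factors; the order of the factors
  -- matters as k need not be commutative.
  noncomm_ring

end PushoutProduct

/-! ### Cubes of tensor products -/

section Cube

variable {W : Type u} [Category.{v} W] [MonoidalCategory W]

/-- The unit object or `B`, according to a Boolean. -/
def sideObj (B : W) (b : Bool) : W := bif b then 𝟙_ W else B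

/-- The maps between the objects `sideObj B b` induced by a partially defined `𝟙 ⟶ B`. -/
def sideMap {B : W} : (b b' : Bool) → b' ≤ b → (b = true → (𝟙_ W ⟶ B)) →
    (sideObj B b ⟶ sideObj B b')
  | true, true, _, _ => 𝟙 _
  | true, false, _, e => e rfl
  | false, false, _, _ => 𝟙 _
  | false, true, h, _ => absurd h (by decide)

theorem sideMap_self {B : W} (b : Bool) (h : b ≤ b) (e : b = true → (𝟙_ W ⟶ B)) :
    sideMap b b h e = 𝟙 _ := by
  cases b <;> rfl

theorem sideMap_comp {B : W} (b b' b'' : Bool) (h : b' ≤ b) (h' : b'' ≤ b')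
    (e : b = true → (𝟙_ W ⟶ B)) :
    sideMap b b' h e ≫ sideMap b' b'' h' (fun hb => e (by subst hb; exact top_le_iff.1 h)) =
      sideMap b b'' (h'.trans h) e := by
  cases b <;> cases b' <;> cases b'' <;>
    first
      | exact Category.id_comp _
      | exact Category.comp_id _
      | exact absurd h (by decide)
      | exact absurd h' (by decide)

/-- The tensor product of the `B i`, with those for which `T i` holds replaced by the unit object,
and of `M`. -/
def cubeObj : (n : ℕ) → (Fin n → W) → W → (Fin n → Bool) → W
  | 0, _, M, _ => M
  | n + 1, B, M, T => sideObj (B 0) (T 0) ⊗ cubeObj n (fun i => B i.succ) M (fun i => T i.succ)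

/-- The edges of the cube: tensor products of identities and of the maps `e i : 𝟙 ⟶ B i`. -/
def cubeMap : (n : ℕ) → (B : Fin n → W) → (M : W) → (D : Fin n → Prop) →
    (e : ∀ i, D i → (𝟙_ W ⟶ B i)) → (T T' : Fin n → Bool) → T' ≤ T → (∀ i, T i = true → D i) →
    (cubeObj n B M T ⟶ cubeObj n B M T')
  | 0, _, _, _, _, _, _, _, _ => 𝟙 _
  | n + 1, B, M, D, e, T, T', h, hT =>
      sideMap (T 0) (T' 0) (h 0) (fun hb => e 0 (hT 0 hb)) ⊗ₘ
        cubeMap n (fun i => B i.succ) M (fun i => D i.succ) (fun i => e i.succ)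
          (fun i => T i.succ) (fun i => T' i.succ) (fun i => h i.succ) (fun i => hT i.succ)

theorem cubeMap_self (n : ℕ) (B : Fin n → W) (M : W) (D : Fin n → Prop)
    (e : ∀ i, D i → (𝟙_ W ⟶ B i)) (T : Fin n → Bool) (h : T ≤ T) (hT : ∀ i, T i = true → D i) :
    cubeMap n B M D e T T h hT = 𝟙 _ := by
  induction n with
  | zero => rfl
  | succ n ih =>
    simp only [cubeMap, ih, sideMap_self, id_tensorHom_id]
    rfl

theorem cubeMap_comp (n : ℕ) (B : Fin n → W) (M : W) (D : Fin n → Prop)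
    (e : ∀ i, D i → (𝟙_ W ⟶ B i)) (T T' T'' : Fin n → Bool) (h : T' ≤ T) (h' : T'' ≤ T')
    (hT : ∀ i, T i = true → D i) (hT' : ∀ i, T' i = true → D i) :
    cubeMap n B M D e T T' h hT ≫ cubeMap n B M D e T' T'' h' hT' =
      cubeMap n B M D e T T'' (h'.trans h) hT := by
  induction n with
  | zero => exact Category.id_comp _
  | succ n ih =>
    exact (tensorHom_comp_tensorHom _ _ _ _).trans
      (congrArg₂ (· ⊗ₘ ·) (sideMap_comp _ _ _ _ _ _) (ih _ _ _ _ _ _ _ _ _ _))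

/-- The punctured cube: the vertices in which some `B i` with `D i`, and none without, is replaced by
the unit object. -/
structure PuncturedCube {n : ℕ} (D : Fin n → Prop) where
  T : Fin n → Bool
  exists_true : ∃ i, T i = true
  imp : ∀ i, T i = true → D i

namespace PuncturedCube

/-- The order is reversed so that morphisms turn units into factors B i. The excluded all-false
vertex would be the terminal one. -/
instance {n : ℕ} (D : Fin n → Prop) : Preorder (PuncturedCube D) where
  le a b := b.T ≤ a.T
  le_refl a := le_refl a.T
  le_trans a b c hab hbc := le_trans (α := Fin n → Bool) hbc hab

/-- The morphism of the punctured cube given by an inequality. -/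
def homOfLE {n : ℕ} {D : Fin n → Prop} {a b : PuncturedCube D} (h : b.T ≤ a.T) : a ⟶ b :=
  CategoryTheory.homOfLE h

/-- Extension of a vertex by one coordinate. -/
def cons {n : ℕ} {D : Fin (n + 1) → Prop} (b : Bool) (t : Fin n → Bool) (hb : b = true → D 0)
    (ht : ∀ i, t i = true → D i.succ) (h : b = false → ∃ i, t i = true) : PuncturedCube D where
  T := Fin.cons b t
  exists_true := by
    cases b with
    | true => exact ⟨0, rfl⟩
    | false => exact (h rfl).imp' Fin.succ fun i hi => hi
  imp := Fin.cases hb ht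

theorem cons_cases {n : ℕ} {D : Fin (n + 1) → Prop} {p : PuncturedCube D → Prop}
    (h : ∀ b t hb ht hn, p (cons b t hb ht hn)) (a : PuncturedCube D) : p a := by
  obtain ⟨T, ⟨i, hi⟩, hT⟩ := a
  obtain ⟨b, t, rfl⟩ : ∃ b t, T = Fin.cons b t := ⟨T 0, Fin.tail T, (Fin.cons_self_tail T).symm⟩
  refine h b t (hT 0) (fun i => hT i.succ) ?_
  rintro rfl
  induction i using Fin.cases with
  | zero => exact absurd hi (by simp)
  | succ i => exact ⟨i, hi⟩

end PuncturedCube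

/-- The restriction of the cube to the punctured cube. -/
def cubeFunctor {n : ℕ} (B : Fin n → W) (M : W) {D : Fin n → Prop}
    (e : ∀ i, D i → (𝟙_ W ⟶ B i)) : PuncturedCube D ⥤ W where
  obj a := cubeObj n B M a.T
  map {a b} f := cubeMap n B M D e a.T b.T (leOfHom f) a.imp
  map_id _ := cubeMap_self ..
  map_comp _ _ := (cubeMap_comp ..).symm

end Cube

/-! ### The colimit over the punctured cube as an iterated pushout-product -/

section CubeLeg

variable {W : Type u} [Category.{v} W] [MonoidalCategory W] {n : ℕ} {B : Fin n → W} {M : W}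
  {D : Fin n → Prop} {e : ∀ i, D i → (𝟙_ W ⟶ B i)} (c : Cocone (cubeFunctor B M e))

/-- A leg of a cocone over the punctured cube. -/
def cubeLeg (t : Fin n → Bool) (hn : ∃ i, t i = true) (ht : ∀ i, t i = true → D i) :
    cubeObj n B M t ⟶ c.pt :=
  c.ι.app ⟨t, hn, ht⟩

theorem cubeLeg_w (t t' : Fin n → Bool) (h : t' ≤ t) (hn : ∃ i, t i = true)
    (ht : ∀ i, t i = true → D i) (hn' : ∃ i, t' i = true) (ht' : ∀ i, t' i = true → D i) :
    cubeMap n B M D e t t' h ht ≫ cubeLeg c t' hn' ht' = cubeLeg c t hn ht :=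
  c.w (j' := ⟨t, hn, ht⟩)
    (j := ⟨t', hn', ht'⟩) (PuncturedCube.homOfLE h)

/-- The map from the apex of a cocone over the punctured cube is compatible with the cube. -/
def IsCubeComparison (u : c.pt ⟶ cubeObj n B M fun _ => false) : Prop :=
  ∀ (t : Fin n → Bool) (hn : ∃ i, t i = true) (ht : ∀ i, t i = true → D i),
    cubeLeg c t hn ht ≫ u = cubeMap n B M D e t (fun _ => false) (fun _ => Bool.false_le _) ht

end CubeLeg

section CubeColimit

variable {W : Type u} [Category.{v} W] [MonoidalCategory W]
  {n : ℕ} {B : Fin (n + 1) → W} {M : W} {D : Fin (n + 1) → Prop} {e : ∀ i, D i → (𝟙_ W ⟶ B i)}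

/-- The part of a cocone over the punctured cube on which the first factor is the unit object. -/
def legTrue (s : Cocone (cubeFunctor B M e)) (h0 : D 0) (t : Fin n → Bool)
    (ht : ∀ i, t i = true → D i.succ) :
    𝟙_ W ⊗ cubeObj n (fun i => B i.succ) M t ⟶ s.pt :=
  s.ι.app (PuncturedCube.cons true t (fun _ => h0) ht (by simp))

/-- The part of a cocone over the punctured cube on which the first factor is `B 0`. -/
def legFalse (s : Cocone (cubeFunctor B M e)) (t : Fin n → Bool) (hn : ∃ i, t i = true)
    (ht : ∀ i, t i = true → D i.succ) :
    B 0 ⊗ cubeObj n (fun i => B i.succ) M t ⟶ s.pt :=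
  s.ι.app (PuncturedCube.cons false t (by simp) ht (fun _ => hn))

/-- If D 0 holds, the punctured (n + 1)-cube consists of a full n-cube, where the first factor is
the unit, and a punctured n-cube, where it is B 0. This lemma and the next two give the cocone
relations within each part and between them; these determine all others. -/
theorem legTrue_w (s : Cocone (cubeFunctor B M e)) (h0 : D 0) (t t' : Fin n → Bool)
    (h : t' ≤ t) (ht : ∀ i, t i = true → D i.succ) (ht' : ∀ i, t' i = true → D i.succ) :
    𝟙_ W ◁ cubeMap n (fun i => B i.succ) M (fun i => D i.succ) (fun i => e i.succ) t t' h ht ≫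
      legTrue s h0 t' ht' = legTrue s h0 t ht := by
  rw [← id_tensorHom]
  exact s.w (j' := PuncturedCube.cons true t (fun _ => h0) ht (by simp))
    (j := PuncturedCube.cons true t' (fun _ => h0) ht' (by simp))
    (PuncturedCube.homOfLE (Fin.cases le_rfl h))

theorem legFalse_w (s : Cocone (cubeFunctor B M e)) (t t' : Fin n → Bool)
    (h : t' ≤ t) (hn : ∃ i, t i = true) (ht : ∀ i, t i = true → D i.succ)
    (hn' : ∃ i, t' i = true) (ht' : ∀ i, t' i = true → D i.succ) :
    B 0 ◁ cubeMap n (fun i => B i.succ) M (fun i => D i.succ) (fun i => e i.succ) t t' h ht ≫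
      legFalse s t' hn' ht' = legFalse s t hn ht := by
  rw [← id_tensorHom]
  exact s.w (j' := PuncturedCube.cons false t (by simp) ht (fun _ => hn))
    (j := PuncturedCube.cons false t' (by simp) ht' (fun _ => hn'))
    (PuncturedCube.homOfLE (Fin.cases le_rfl h))

theorem legFalse_legTrue (s : Cocone (cubeFunctor B M e)) (h0 : D 0) (t : Fin n → Bool)
    (hn : ∃ i, t i = true) (ht : ∀ i, t i = true → D i.succ) :
    e 0 h0 ▷ cubeObj n (fun i => B i.succ) M t ≫ legFalse s t hn ht = legTrue s h0 t ht := by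
  rw [← tensorHom_id, ← cubeMap_self n (fun i => B i.succ) M (fun i => D i.succ)
    (fun i => e i.succ) t le_rfl ht]
  exact s.w (j' := PuncturedCube.cons true t (fun _ => h0) ht (by simp))
    (j := PuncturedCube.cons false t (by simp) ht (fun _ => hn))
    (PuncturedCube.homOfLE (Fin.cases (Bool.false_le _) fun _ => le_rfl))

/-- A cocone over the punctured cube of dimension `n + 1` from its two parts. -/
def consCocone (P : W)
    (l : ∀ (t : Fin n → Bool), (∃ i, t i = true) → (∀ i, t i = true → D i.succ) →
      (B 0 ⊗ cubeObj n (fun i => B i.succ) M t ⟶ P))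
    (r : D 0 → ∀ (t : Fin n → Bool), (∀ i, t i = true → D i.succ) →
      (𝟙_ W ⊗ cubeObj n (fun i => B i.succ) M t ⟶ P))
    (hl : ∀ t t' h hn ht hn' ht', B 0 ◁ cubeMap n (fun i => B i.succ) M (fun i => D i.succ)
      (fun i => e i.succ) t t' h ht ≫ l t' hn' ht' = l t hn ht)
    (hr : ∀ h0 t t' h ht ht', 𝟙_ W ◁ cubeMap n (fun i => B i.succ) M (fun i => D i.succ)
      (fun i => e i.succ) t t' h ht ≫ r h0 t' ht' = r h0 t ht)
    (hlr : ∀ h0 t hn ht, e 0 h0 ▷ cubeObj n (fun i => B i.succ) M t ≫ l t hn ht = r h0 t ht) :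
    Cocone (cubeFunctor B M e) where
  pt := P
  ι :=
    let leg : (b : Bool) → (t : Fin n → Bool) → (b = true → D 0) →
        (b = false → ∃ i, t i = true) → (∀ i, t i = true → D i.succ) →
        (sideObj (B 0) b ⊗ cubeObj n (fun i => B i.succ) M t ⟶ P) := fun b t =>
      match b with
      | true => fun h0 _ ht => r (h0 rfl) t ht
      | false => fun _ hn ht => l t (hn rfl) ht
    have w : ∀ b b' t t' hb h hb0 hn ht hb0' hn' ht',
        (sideMap b b' hb (fun hb => e 0 (hb0 hb)) ⊗ₘ cubeMap n (fun i => B i.succ) M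
          (fun i => D i.succ) (fun i => e i.succ) t t' h ht) ≫ leg b' t' hb0' hn' ht' =
        leg b t hb0 hn ht := by
      intro b b' t t' hb h hb0 hn ht hb0' hn' ht'
      cases b with
      | true =>
        cases b' with
        | true =>
          change (𝟙 (𝟙_ W) ⊗ₘ _) ≫ r _ _ _ = r _ _ _
          rw [id_tensorHom, hr]
        | false =>
          -- A mixed edge is e 0 at the corner t followed by an edge of the B 0 part. That corner is
          -- in the punctured cube because t' ≤ t and t' has a true coordinate.
          obtain ⟨i, hi⟩ := hn' rfl
          have ht0 : ∃ i, t i = true := ⟨i, top_le_iff.1 (hi ▸ h i :)⟩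
          change (e 0 _ ⊗ₘ _) ≫ l _ _ _ = r _ _ _
          rw [tensorHom_def_assoc, hl t t' h ht0 ht, hlr]
      | false =>
        cases b' with
        | true => exact absurd hb (by decide)
        | false =>
          change (𝟙 (B 0) ⊗ₘ _) ≫ l _ _ _ = l _ _ _
          rw [id_tensorHom, hl t t' h (hn rfl) ht]
    { app a := leg (a.T 0) (fun i => a.T i.succ) (a.imp 0)
        (by
          intro h
          obtain ⟨i, hi⟩ := a.exists_true
          induction i using Fin.cases with
          | zero => exact absurd hi (by simp [h])
          | succ i => exact ⟨i, hi⟩)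
        (fun i => a.imp i.succ)
      naturality a b f := (w (a.T 0) (b.T 0) _ _ (leOfHom f 0) (fun i => leOfHom f i.succ)
        (a.imp 0) _ _ _ _ _).trans (Category.comp_id _).symm }

theorem cocone_hom_ext {s : Cocone (cubeFunctor B M e)} {s' : Cocone (cubeFunctor B M e)}
    (m : s.pt ⟶ s'.pt) (hl : ∀ t hn ht, legFalse s t hn ht ≫ m = legFalse s' t hn ht)
    (hr : ∀ h0 t ht, legTrue s h0 t ht ≫ m = legTrue s' h0 t ht) (a : PuncturedCube D) :
    s.ι.app a ≫ m = s'.ι.app a := by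
  induction a using PuncturedCube.cons_cases with
  | h b t hb ht hn =>
    cases b with
    | true => exact hr (hb rfl) t ht
    | false => exact hl t (hn rfl) ht

theorem isCubeComparison_of_legs (s : Cocone (cubeFunctor B M e))
    (u : s.pt ⟶ B 0 ⊗ cubeObj n (fun i => B i.succ) M fun _ => false)
    (hl : ∀ t hn ht, legFalse s t hn ht ≫ u = B 0 ◁ cubeMap n (fun i => B i.succ) M
      (fun i => D i.succ) (fun i => e i.succ) t (fun _ => false) (fun _ => Bool.false_le _) ht)
    (hr : ∀ h0 t ht, legTrue s h0 t ht ≫ u = e 0 h0 ⊗ₘ cubeMap n (fun i => B i.succ) M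
      (fun i => D i.succ) (fun i => e i.succ) t (fun _ => false) (fun _ => Bool.false_le _) ht) :
    IsCubeComparison s u := by
  intro t hn ht
  refine PuncturedCube.cons_cases (p := fun a => s.ι.app a ≫ u =
    cubeMap (n + 1) B M D e a.T (fun _ => false) (fun _ => Bool.false_le _) a.imp) ?_ ⟨t, hn, ht⟩
  rintro (_ | _) t hb ht hn
  · exact (hl t (hn rfl) ht).trans (id_tensorHom _ _).symm
  · exact hr (hb rfl) t ht

variable [MonoidalClosed W]
  {c : Cocone (cubeFunctor (fun i => B i.succ) M fun i => e i.succ)} (hc : IsColimit c)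

include hc in
-- By closedness A ⊗ - preserves colimits, so the tensored legs are jointly epimorphic.
theorem tensor_cubeLeg_hom_ext (A : W) {Q : W} {f g : A ⊗ c.pt ⟶ Q}
    (h : ∀ t hn ht, A ◁ cubeLeg c t hn ht ≫ f = A ◁ cubeLeg c t hn ht ≫ g) : f = g :=
  (isColimitOfPreserves (tensorLeft A) hc).hom_ext fun a => h a.T a.exists_true a.imp

/-- The map out of `B 0 ⊗ c.pt` given by the legs of a cocone. -/
noncomputable def descFalse (s : Cocone (cubeFunctor B M e)) : B 0 ⊗ c.pt ⟶ s.pt :=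
  (isColimitOfPreserves (tensorLeft (B 0)) hc).desc
    { pt := s.pt
      ι :=
        { app a := legFalse s a.T a.exists_true a.imp
          naturality a b f := (legFalse_w s a.T b.T (leOfHom f) _ a.imp _ _).trans
            (Category.comp_id _).symm } }

theorem cubeLeg_descFalse (s : Cocone (cubeFunctor B M e)) (t : Fin n → Bool)
    (hn : ∃ i, t i = true) (ht : ∀ i, t i = true → D i.succ) :
    B 0 ◁ cubeLeg c t hn ht ≫ descFalse hc s = legFalse s t hn ht :=
  (isColimitOfPreserves (tensorLeft (B 0)) hc).fac _ ⟨t, hn, ht⟩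

include hc in
-- The first factor is never the unit, so the diagram is B 0 tensored with the punctured n-cube.
-- This is the pushout-product with ∅ ⟶ B 0.
theorem exists_isColimit_of_not (h0 : ¬ D 0)
    {u : c.pt ⟶ cubeObj n (fun i => B i.succ) M fun _ => false} (hu : IsCubeComparison c u) :
    ∃ (c' : Cocone (cubeFunctor B M e)) (_ : IsColimit c') (i : c'.pt ≅ B 0 ⊗ c.pt),
      IsCubeComparison c' (i.hom ≫ B 0 ◁ u) := by
  refine ⟨consCocone (B 0 ⊗ c.pt) (fun t hn ht => B 0 ◁ cubeLeg c t hn ht)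
    (fun h => absurd h h0) ?_ (fun h => absurd h h0) (fun h => absurd h h0), ?_, Iso.refl _, ?_⟩
  · intro t t' h hn ht hn' ht'
    rw [← whiskerLeft_comp, cubeLeg_w c t t' h hn ht]
  · exact
      { desc s := descFalse hc s
        fac s := cocone_hom_ext _ (fun t hn ht => cubeLeg_descFalse hc s t hn ht)
          (fun h => absurd h h0)
        uniq s m hm := tensor_cubeLeg_hom_ext hc _ fun t hn ht =>
          (hm (PuncturedCube.cons false t (by simp) ht (fun _ => hn))).trans
            (cubeLeg_descFalse hc s t hn ht).symm }
  · refine isCubeComparison_of_legs _ _ (fun t hn ht => ?_) (fun h => absurd h h0)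
    change B 0 ◁ cubeLeg c t hn ht ≫ 𝟙 _ ≫ B 0 ◁ u = _
    rw [Category.id_comp, ← whiskerLeft_comp, hu]

include hc in
-- The full n-cube on which the first factor is the unit has a terminal vertex, so its colimit is 𝟙
-- ⊗ F with F the all-false corner. The B 0 part has colimit B 0 ⊗ c.pt, and the two are glued along
-- 𝟙 ⊗ c.pt: this is the pushout defining the pushout-product of e 0 with u.
theorem exists_isColimit_of_isPushout (h0 : D 0)
    {u : c.pt ⟶ cubeObj n (fun i => B i.succ) M fun _ => false} (hu : IsCubeComparison c u)
    {P : W} {inl : B 0 ⊗ c.pt ⟶ P}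
    {inr : 𝟙_ W ⊗ cubeObj n (fun i => B i.succ) M (fun _ => false) ⟶ P}
    (sq : IsPushout (e 0 h0 ▷ c.pt) (𝟙_ W ◁ u) inl inr)
    (u' : P ⟶ B 0 ⊗ cubeObj n (fun i => B i.succ) M fun _ => false)
    (hl : inl ≫ u' = B 0 ◁ u) (hr : inr ≫ u' = e 0 h0 ▷ _) :
    ∃ (c' : Cocone (cubeFunctor B M e)) (_ : IsColimit c') (i : c'.pt ≅ P),
      IsCubeComparison c' (i.hom ≫ u') := by
  -- Each leg of the unit part passes through its terminal vertex.
  obtain ⟨r, r_eq⟩ : ∃ r : D 0 → ∀ (t : Fin n → Bool), (∀ i, t i = true → D i.succ) →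
      (𝟙_ W ⊗ cubeObj n (fun i => B i.succ) M t ⟶ P), ∀ h0 t ht, r h0 t ht =
    𝟙_ W ◁ cubeMap n (fun i => B i.succ) M (fun i => D i.succ) (fun i => e i.succ) t
      (fun _ => false) (fun _ => Bool.false_le _) ht ≫ inr := ⟨_, fun _ _ _ => rfl⟩
  have h₁ : ∀ (t t' : Fin n → Bool) (h : t' ≤ t) (hn : ∃ i, t i = true)
      (ht : ∀ i, t i = true → D i.succ) (hn' : ∃ i, t' i = true) (ht'),
      B 0 ◁ cubeMap n (fun i => B i.succ) M (fun i => D i.succ)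
      (fun i => e i.succ) t t' h ht ≫ B 0 ◁ cubeLeg c t' hn' ht' ≫ inl =
        B 0 ◁ cubeLeg c t hn ht ≫ inl := by
    intro t t' h hn ht hn' ht'
    rw [← whiskerLeft_comp_assoc, cubeLeg_w c t t' h hn ht]
  have h₂ : ∀ (h0 : D 0) (t t' : Fin n → Bool) (h : t' ≤ t)
      (ht : ∀ i, t i = true → D i.succ) (ht'),
      𝟙_ W ◁ cubeMap n (fun i => B i.succ) M (fun i => D i.succ)
      (fun i => e i.succ) t t' h ht ≫ r h0 t' ht' = r h0 t ht := by
    intro h0 t t' h ht ht'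
    rw [r_eq, r_eq, ← whiskerLeft_comp_assoc, cubeMap_comp]
  have h₃ : ∀ (h0 : D 0) (t : Fin n → Bool) (hn : ∃ i, t i = true)
      (ht : ∀ i, t i = true → D i.succ), e 0 h0 ▷ cubeObj n (fun i => B i.succ) M t ≫
        B 0 ◁ cubeLeg c t hn ht ≫ inl = r h0 t ht := by
    intro h0 t hn ht
    rw [r_eq, ← whisker_exchange_assoc, sq.w, ← whiskerLeft_comp_assoc, hu]
  -- The maps induced by a cocone on the two parts agree on 𝟙 ⊗ c.pt, as can be tested on the legs
  -- of c.
  have hd : ∀ s : Cocone (cubeFunctor B M e), e 0 h0 ▷ c.pt ≫ descFalse hc s =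
      𝟙_ W ◁ u ≫ legTrue s h0 (fun _ => false) (by simp) := fun s => by
    refine tensor_cubeLeg_hom_ext hc _ fun t hn ht => ?_
    rw [whisker_exchange_assoc, cubeLeg_descFalse, legFalse_legTrue, ← whiskerLeft_comp_assoc,
      hu t hn ht, legTrue_w]
  have hm' : ∀ (s : Cocone (cubeFunctor B M e)) (m : P ⟶ s.pt)
      (_ : ∀ t hn ht, (B 0 ◁ cubeLeg c t hn ht ≫ inl) ≫ m = legFalse s t hn ht)
      (_ : r h0 (fun _ => false) (by simp) ≫ m = legTrue s h0 (fun _ => false) (by simp)),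
      m = sq.desc (descFalse hc s) (legTrue s h0 (fun _ => false) (by simp)) (hd s) := by
    intro s m h h'
    refine sq.hom_ext ?_ ?_
    · rw [sq.inl_desc]
      refine tensor_cubeLeg_hom_ext hc _ fun t hn ht => ?_
      rw [cubeLeg_descFalse, ← h, Category.assoc]
    · rw [sq.inr_desc, ← h', r_eq, cubeMap_self, whiskerLeft_id, Category.id_comp]
  refine ⟨consCocone P (fun t hn ht => B 0 ◁ cubeLeg c t hn ht ≫ inl) r h₁ h₂ h₃, ?_, Iso.refl _, ?_⟩
  · exact
      { desc s := sq.desc (descFalse hc s) (legTrue s h0 (fun _ => false) (by simp)) (hd s)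
        fac s := by
          refine cocone_hom_ext (s := consCocone P _ r h₁ h₂ h₃) _ (fun t hn ht => ?_)
            (fun h0 t ht => ?_)
          · change (B 0 ◁ cubeLeg c t hn ht ≫ inl) ≫ sq.desc _ _ _ = _
            rw [Category.assoc, sq.inl_desc, cubeLeg_descFalse]
          · change r h0 t ht ≫ sq.desc _ _ _ = _
            rw [r_eq, Category.assoc, sq.inr_desc, legTrue_w]
        uniq s m hm := hm' s m
          (fun t hn ht => hm (PuncturedCube.cons false t (by simp) ht (fun _ => hn)))
          (hm (PuncturedCube.cons true (fun _ => false) (fun _ => h0) (by simp) (by simp))) }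
  · refine isCubeComparison_of_legs _ _ (fun t hn ht => ?_) (fun h0 t ht => ?_)
    · change (B 0 ◁ cubeLeg c t hn ht ≫ inl) ≫ 𝟙 _ ≫ u' = _
      rw [Category.id_comp, Category.assoc, hl, ← whiskerLeft_comp, hu]
    · change r h0 t ht ≫ 𝟙 _ ≫ u' = _
      rw [r_eq, Category.id_comp, Category.assoc, hr, tensorHom_def']

end CubeColimit

/-! ### The Euler characteristic of the colimit over the punctured cube -/

section CubeEuler

open scoped Classical in
/-- The product `∏ (b i - [D i])`, times `m`. -/
noncomputable def cubeWeight {k : Type w} [Ring k] (m : k) :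
    (n : ℕ) → (Fin n → k) → (Fin n → Prop) → k
  | 0, _, _ => m
  | n + 1, b, D => (b 0 - if D 0 then 1 else 0) *
      cubeWeight m n (fun i => b i.succ) (fun i => D i.succ)

variable {W : Type u} [Category.{v} W] [ModelCategory W] [MonoidalCategory W] [SymmetricCategory W]
  [MonoidalClosed W] [SymmetricMonoidalModelCategory W]
  {k : Type w} [Ring k] (χ : MultiplicativeEulerCharacteristic W k)

/-- Induction on the number of factors. Cofibrancy and finiteness of the colimit, and the fact that
u is a cofibration, are carried along because the next pushout-product or tensor product needs them.
-/
theorem exists_isColimit_cubeFunctor (M : W) (hM : IsCofibrant M) (hM' : χ.IsFinite M) (n : ℕ)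
    (B : Fin n → W) (D : Fin n → Prop) (e : ∀ i, D i → (𝟙_ W ⟶ B i))
    (hB : ∀ i, IsCofibrant (B i)) (hB' : ∀ i, χ.IsFinite (B i)) (he : ∀ i h, Cofibration (e i h)) :
    ∃ (c : Cocone (cubeFunctor B M e)) (_ : IsColimit c)
      (u : c.pt ⟶ cubeObj n B M fun _ => false), IsCubeComparison c u ∧ Cofibration u ∧
      IsCofibrant c.pt ∧ χ.IsFinite c.pt ∧ χ.IsFinite (cubeObj n B M fun _ => false) ∧
      χ.val (cubeObj n B M fun _ => false) - χ.val c.pt =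
        cubeWeight (χ.val M) n (fun i => χ.val (B i)) D := by
  induction n with
  | zero =>
    -- The 0-cube has only the vertex that is removed, so the colimit is initial and u is ∅ ⟶ M.
    have : IsEmpty (PuncturedCube D) := ⟨fun a => a.exists_true.choose.elim0⟩
    refine ⟨⟨⊥_ W, { app a := isEmptyElim a, naturality a := isEmptyElim a }⟩,
      { desc s := initial.to s.pt
        fac s a := isEmptyElim a
        uniq s m _ := Subsingleton.elim _ _ },
      initial.to M, fun t hn => hn.choose.elim0, hM, ?_, χ.isFinite_initial, hM', ?_⟩
    · exact (isCofibrant_iff_of_isInitial (𝟙 (⊥_ W)) initialIsInitial).2 inferInstance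
    · change χ.val M - χ.val (⊥_ W) = χ.val M
      rw [χ.val_initial, sub_zero]
  | succ n ih =>
    obtain ⟨c, hc, u, hu, hu', hL, hL', hF, hval⟩ := ih (fun i => B i.succ) (fun i => D i.succ)
      (fun i => e i.succ) (fun i => hB i.succ) (fun i => hB' i.succ) (fun i => he i.succ)
    have hF' : IsCofibrant (cubeObj n (fun i => B i.succ) M fun _ => false) :=
      isCofibrant_of_cofibration u
    have hB0 := hB 0
    have hBF : χ.IsFinite (cubeObj (n + 1) B M fun _ => false) :=
      χ.isFinite_tensor (hB' 0) hF hB0 hF'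
    by_cases h0 : D 0
    · have he0 := he 0 h0
      have hI : IsCofibrant (𝟙_ W) := SymmetricMonoidalModelCategory.unit_cofibrant
      let sq := IsPushout.of_hasPushout (e 0 h0 ▷ c.pt) (𝟙_ W ◁ u)
      obtain ⟨c', hc', i, hi⟩ := exists_isColimit_of_isPushout hc h0 hu sq
        (sq.desc (B 0 ◁ u) (e 0 h0 ▷ _) (whisker_exchange _ _).symm)
        (sq.inl_desc _ _ _) (sq.inr_desc _ _ _)
      -- Pushout-product with the cofibration 𝟙 ⟶ B 0, which contributes the factor χ(B 0) - 1.
      obtain ⟨h1, h2, h3, h4⟩ := χ.pushoutProduct (e 0 h0) u χ.isFinite_unit (hB' 0) hL' hF sq _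
        (sq.inl_desc (B 0 ◁ u) (e 0 h0 ▷ _) (whisker_exchange _ _).symm) (sq.inr_desc _ _ _)
      refine ⟨c', hc', _, hi, (cofibration_iff _).2 ((cofibrations W).comp_mem _ _
        (mem_cofibrations i.hom) h1.mem), isCofibrant_of_iso i.symm,
        (χ.isFinite_iff_of_iso i).2 h3, hBF, ?_⟩
      rw [χ.val_eq_of_iso i ((χ.isFinite_iff_of_iso i).2 h3)]
      refine h4.trans ?_
      rw [hval, χ.val_unit, cubeWeight, if_pos h0]
    · obtain ⟨c', hc', i, hi⟩ := exists_isColimit_of_not (B := B) (e := e) hc h0 hu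
      have h3 := χ.isFinite_tensor (hB' 0) hL' hB0 hL
      have hBu := cofibration_whiskerLeft (B 0) u
      have := isCofibrant_tensor (B 0) c.pt
      refine ⟨c', hc', _, hi, (cofibration_iff _).2 ((cofibrations W).comp_mem _ _
        (mem_cofibrations i.hom) hBu.mem), isCofibrant_of_iso i.symm,
        (χ.isFinite_iff_of_iso i).2 h3, hBF, ?_⟩
      rw [χ.val_eq_of_iso i ((χ.isFinite_iff_of_iso i).2 h3), χ.val_tensor (hB' 0) hL' hB0 hL,
        cubeWeight, if_neg h0, ← hval, sub_zero, mul_sub]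
      exact congrArg (· - _) (χ.val_tensor (hB' 0) hF hB0 hF')

end CubeEuler

/-! ### Sums over paths and the Neumann series -/

section Matrix

variable {k : Type w₁} [Ring k] {X : Type w} [Fintype X] [DecidableEq X]

/-- The summand is the product of the entries of Z - 1 along the path x; splitting off the first
vertex is matrix multiplication. -/
theorem sum_cubeWeight (Z : Matrix X X k) (n : ℕ) (a b : X) :
    ∑ x : Fin (n + 1) → X with x 0 = a ∧ x (Fin.last n) = b,
      cubeWeight 1 n (fun i => Z (x i.castSucc) (x i.succ)) (fun i => x i.castSucc = x i.succ) =
    ((Z - 1) ^ n) a b := by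
  classical
  induction n generalizing a with
  | zero =>
    rw [Finset.sum_filter, pow_zero, Matrix.one_apply]
    refine (Fintype.sum_equiv (Equiv.funUnique (Fin 1) X) _
      (fun y => if y = a ∧ y = b then (1 : k) else 0) (fun x => rfl)).trans ?_
    simp [ite_and]
  | succ n ih =>
    rw [pow_succ', Matrix.mul_apply, Finset.sum_filter,
      ← (Fin.consEquiv fun _ : Fin (n + 2) => X).sum_comp, Fintype.sum_prod_type]
    -- Only paths with first vertex a contribute. The claim `key` then writes each summand as a sum
    -- over its second vertex j, to match the matrix product.
    rw [Finset.sum_eq_single a]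
    · have key : ∀ x : Fin (n + 1) → X,
          (if (Fin.consEquiv fun _ : Fin (n + 2) => X) (a, x) 0 = a ∧
            (Fin.consEquiv fun _ : Fin (n + 2) => X) (a, x) (Fin.last (n + 1)) = b then
            cubeWeight 1 (n + 1) (fun i => Z ((Fin.consEquiv fun _ : Fin (n + 2) => X) (a, x)
                i.castSucc) ((Fin.consEquiv fun _ : Fin (n + 2) => X) (a, x) i.succ))
              (fun i => (Fin.consEquiv fun _ : Fin (n + 2) => X) (a, x) i.castSucc =
                (Fin.consEquiv fun _ : Fin (n + 2) => X) (a, x) i.succ) else 0) =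
          ∑ j, if x 0 = j ∧ x (Fin.last n) = b then (Z - 1) a j * cubeWeight 1 n
            (fun i => Z (x i.castSucc) (x i.succ)) (fun i => x i.castSucc = x i.succ) else 0 := by
        intro x
        simp only [ite_and, Finset.sum_ite_eq, Finset.mem_univ, if_true]
        refine (if_pos rfl).trans (if_congr Iff.rfl ?_ rfl)
        refine congrArg (fun q : k => q * _) ?_
        rw [Matrix.sub_apply, Matrix.one_apply]
        -- `cubeWeight` decides equality classically, `Matrix.one_apply` by the given `DecidableEq
        -- X`.
        have dec : ∀ d d' : Decidable (a = x 0), @ite k _ d 1 0 = @ite k _ d' 1 0 := by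
          intro d d'
          congr
        exact congrArg (Z a (x 0) - ·) (dec _ _)
      rw [Finset.sum_congr rfl fun x _ => key x, Finset.sum_comm]
      refine Finset.sum_congr rfl fun j _ => ?_
      rw [← ih, Finset.mul_sum, Finset.sum_filter]
    · intro a' _ ha
      exact Finset.sum_eq_zero fun x _ => if_neg fun h => ha h.1
    · exact fun h => absurd (Finset.mem_univ a) h

variable [TopologicalSpace k] [IsTopologicalRing k] [T2Space k]

/-- If the Neumann series of `1 - Z` converges, its sum is the inverse of `Z`. -/
theorem inverse_of_tendsto_geom {R : Type*} [Ring R] [TopologicalSpace R] [IsTopologicalRing R]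
    [T2Space R] {Z s : R}
    (h : Tendsto (fun N : ℕ => ∑ n ∈ Finset.range N, (1 - Z) ^ n) atTop (𝓝 s)) :
    Z * s = 1 ∧ s * Z = 1 := by
  -- The terms of a convergent series are differences of consecutive partial sums, so they tend to
  -- 0.
  have h0 : Tendsto (fun N : ℕ => (1 - Z) ^ N) atTop (𝓝 0) := by
    have h' := (h.comp (tendsto_add_atTop_nat 1)).sub h
    rw [sub_self] at h'
    refine h'.congr fun N => ?_
    simp [Finset.sum_range_succ]
  have h1 : Tendsto (fun N : ℕ => 1 - (1 - Z) ^ N) atTop (𝓝 1) := by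
    simpa using tendsto_const_nhds.sub h0
  constructor
  -- The geometric sum telescopes: Z times the N-th partial sum is 1 - (1 - Z)^N, and likewise on
  -- the other side.
  · refine tendsto_nhds_unique ((tendsto_const_nhds.mul h).congr fun N => ?_) h1
    rw [← mul_neg_geom_sum, sub_sub_cancel]
  · refine tendsto_nhds_unique ((h.mul tendsto_const_nhds).congr fun N => ?_) h1
    rw [← geom_sum_mul_neg, sub_sub_cancel]

/-- Matrices carry the product topology, so entrywise convergence is convergence in the matrix ring
and `inverse_of_tendsto_geom` applies. The total series is a finite sum of the entry series, whence
r is the sum of their limits. -/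
theorem isUnit_and_sum_inverse {Z : Matrix X X k} {r : k}
    (hconv : ∀ a b, ∃ s : k, Tendsto (fun N : ℕ => ∑ n ∈ Finset.range N,
      (-1) ^ n * ((Z - 1) ^ n) a b) atTop (𝓝 s))
    (htot : Tendsto (fun N : ℕ => ∑ n ∈ Finset.range N,
      (-1) ^ n * ∑ a, ∑ b, ((Z - 1) ^ n) a b) atTop (𝓝 r)) :
    ∃ h : IsUnit Z, ∑ a, ∑ b, (↑h.unit⁻¹ : Matrix X X k) a b = r := by
  choose s hs using hconv
  have hpow : ∀ (n : ℕ) a b, (-1) ^ n * ((Z - 1) ^ n) a b = ((1 - Z) ^ n) a b := by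
    intro n a b
    rw [← neg_sub Z 1, neg_pow (Z - 1)]
    -- The sign is a scalar on one side and a matrix on the other; fixing the parity of n makes both
    -- ±1.
    rcases n.even_or_odd with h | h <;> simp [h.neg_one_pow]
  have hS : Tendsto (fun N : ℕ => ∑ n ∈ Finset.range N, (1 - Z) ^ n) atTop
      (𝓝 (Matrix.of s)) := by
    refine tendsto_pi_nhds.2 fun a => tendsto_pi_nhds.2 fun b => (hs a b).congr fun N => ?_
    rw [Matrix.sum_apply]
    exact Finset.sum_congr rfl fun n _ => hpow n a b
  obtain ⟨h1, h2⟩ := inverse_of_tendsto_geom hS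
  have hZ : IsUnit Z := ⟨⟨Z, Matrix.of s, h1, h2⟩, rfl⟩
  refine ⟨hZ, ?_⟩
  have hinv : (↑hZ.unit⁻¹ : Matrix X X k) = Matrix.of s :=
    Units.inv_eq_of_mul_eq_one_right (by simpa using h1)
  rw [hinv]
  refine tendsto_nhds_unique (tendsto_finsetSum _ fun a _ => tendsto_finsetSum _ fun b _ =>
    hs a b) (htot.congr fun N => ?_)
  simp only [Finset.mul_sum]
  rw [Finset.sum_comm]
  refine Finset.sum_congr rfl fun a _ => ?_
  rw [Finset.sum_comm]

end Matrix

/-! ### Degenerate tuples and vertices of the cube -/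

section Collapse

variable {d n : ℕ}

/-- The steps of a sequence that do not move. -/
def collapse (σ : Fin (n + 1) → Fin (d + 1)) (i : Fin n) : Bool :=
  decide (σ i.castSucc = σ i.succ)

theorem collapse_eq_true {σ : Fin (n + 1) → Fin (d + 1)} {i : Fin n} :
    collapse σ i = true ↔ σ i.castSucc = σ i.succ :=
  decide_eq_true_iff

/-- Without collapsed steps σ would be strictly monotone. Together with `lt_of_collapse`, this
matches leaving out the identity degeneracy with removing the all-false vertex of the cube. -/
theorem exists_collapse {σ : Fin (n + 1) → Fin (d + 1)} (hσ : Monotone σ) (h : d < n) :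
    ∃ i, collapse σ i = true := by
  by_contra! hne
  have hmono : StrictMono σ := Fin.strictMono_iff_lt_succ.2 fun i =>
    (hσ (Fin.castSucc_lt_succ (i := i)).le).lt_of_ne fun h => hne i (collapse_eq_true.2 h)
  have := Fintype.card_le_of_injective σ hmono.injective
  simp only [Fintype.card_fin] at this
  omega

theorem lt_of_collapse {σ : Fin (n + 1) → Fin (d + 1)} (hσ : Function.Surjective σ)
    (h : ∃ i, collapse σ i = true) : d < n := by
  obtain ⟨i, hi⟩ := h
  have hle := Fintype.card_le_of_surjective σ hσ
  simp only [Fintype.card_fin] at hle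
  refine lt_of_le_of_ne (by omega) ?_
  rintro rfl
  have := Finite.injective_iff_surjective.2 hσ (collapse_eq_true.1 hi)
  exact (Fin.castSucc_lt_succ (i := i)).ne this

/-- A monotone map that jumps by two misses a value. So every step moves by 0 or 1. -/
theorem step_le_of_surjective {σ : Fin (n + 1) → Fin (d + 1)} (hσ : Monotone σ)
    (hs : Function.Surjective σ) (i : Fin n) : (σ i.succ : ℕ) ≤ σ i.castSucc + 1 := by
  by_contra! h
  obtain ⟨k, hk⟩ := hs ⟨σ i.castSucc + 1, h.trans (σ i.succ).isLt⟩
  have hk' : (σ k : ℕ) = σ i.castSucc + 1 := congrArg Fin.val hk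
  rcases le_or_gt k i.castSucc with hki | hki
  · have : (σ k : ℕ) ≤ σ i.castSucc := hσ hki
    omega
  · have : (σ i.succ : ℕ) ≤ σ k := hσ (Fin.castSucc_lt_iff_succ_le.1 hki)
    omega

theorem map_last_of_surjective {σ : Fin (n + 1) → Fin (d + 1)} (hσ : Monotone σ)
    (hs : Function.Surjective σ) : σ (Fin.last n) = Fin.last d := by
  obtain ⟨k, hk⟩ := hs (Fin.last d)
  exact le_antisymm (Fin.le_last _) (hk ▸ hσ (Fin.le_last k))

theorem map_zero_of_surjective {σ : Fin (n + 1) → Fin (d + 1)} (hσ : Monotone σ)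
    (hs : Function.Surjective σ) : σ 0 = 0 := by
  obtain ⟨k, hk⟩ := hs 0
  exact le_antisymm (hk ▸ hσ (Fin.zero_le k)) (Fin.zero_le _)

/-- A monotone map is constant on the intervals on which all steps are collapsed. -/
theorem eq_of_collapse_le {d' : ℕ} {σ : Fin (n + 1) → Fin (d + 1)}
    {σ' : Fin (n + 1) → Fin (d' + 1)} (hσ' : Monotone σ')
    (h : collapse σ' ≤ collapse σ) (i j : Fin (n + 1)) (hij : i ≤ j) (e : σ' i = σ' j) :
    σ i = σ j := by
  induction j using Fin.induction with
  | zero => rw [le_antisymm hij (Fin.zero_le _)]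
  | succ j ih =>
    rcases hij.eq_or_lt with rfl | hlt
    · rfl
    · have hij' : i ≤ j.castSucc := Fin.le_castSucc_iff.2 hlt
      have h1 : σ' i = σ' j.castSucc :=
        le_antisymm (hσ' hij') (e ▸ hσ' (Fin.castSucc_lt_succ (i := j)).le)
      have h2 : collapse σ' j = true := collapse_eq_true.2 (h1.symm.trans e)
      exact (ih hij' h1).trans (collapse_eq_true.1 (top_le_iff.1 (h2 ▸ h j :)))

/-- Every collapse pattern compatible with `y` comes from a degeneracy onto `y`. -/
theorem exists_degeneracy {Y : Type w} (n : ℕ) (y : Fin (n + 1) → Y) (T : Fin n → Bool)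
    (hT : ∀ i, T i = true → y i.castSucc = y i.succ) :
    ∃ (d : ℕ) (v : Fin (d + 1) → Y) (σ : Fin (n + 1) → Fin (d + 1)),
      Monotone σ ∧ Function.Surjective σ ∧ (∀ k, v (σ k) = y k) ∧ collapse σ = T := by
  induction n with
  | zero =>
    exact ⟨0, y, id, monotone_id, Function.surjective_id, fun _ => rfl, funext fun i => i.elim0⟩
  | succ n ih =>
    obtain ⟨d, v, σ, hσ, hs, hv, hc⟩ := ih (fun i => y i.succ) (fun i => T i.succ)
      (fun i => hT i.succ)
    have h0 := map_zero_of_surjective hσ hs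
    -- Either the new first index is sent to the old first vertex, or a new vertex y 0 is put in
    -- front and σ is shifted.
    by_cases h : T 0 = true
    · refine ⟨d, v, Fin.cases 0 σ, Fin.monotone_iff_le_succ.2 ?_, fun k => ?_, ?_, funext ?_⟩
      · refine Fin.cases (Fin.zero_le _) fun i => ?_
        exact hσ (Fin.castSucc_lt_succ (i := i)).le
      · obtain ⟨i, hi⟩ := hs k
        exact ⟨i.succ, hi⟩
      · refine Fin.cases ?_ hv
        exact (congrArg v h0.symm).trans ((hv 0).trans (hT 0 h).symm)
      · refine Fin.cases ?_ fun i => congrFun hc i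
        rw [h]
        exact collapse_eq_true.2 h0.symm
    · refine ⟨d + 1, Fin.cons (y 0) v, Fin.cases 0 (fun i => (σ i).succ),
        Fin.monotone_iff_le_succ.2 ?_, ?_, Fin.cases rfl hv, funext ?_⟩
      · refine Fin.cases (Fin.zero_le _) fun i => ?_
        exact Fin.succ_le_succ_iff.2 (hσ (Fin.castSucc_lt_succ (i := i)).le)
      · refine Fin.cases ⟨0, rfl⟩ fun k => ?_
        obtain ⟨i, hi⟩ := hs k
        exact ⟨i.succ, congrArg Fin.succ hi⟩
      · refine Fin.cases ?_ fun i => Eq.trans ?_ (congrFun hc i)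
        · rw [Bool.eq_false_of_not_eq_true h]
          exact decide_eq_false (Fin.succ_ne_zero _).symm
        · exact decide_eq_decide.2 Fin.succ_inj

end Collapse

/-! ### The latching diagram as a punctured cube -/

namespace EnrichedBimodule

variable {W : Type u} [Category.{v} W] [MonoidalCategory W]
    {Y : Type w} [EnrichedCategory W Y] (M : EnrichedBimodule W Y)

theorem isIso_act_last (n : ℕ) (y : Fin (n + 1) → Y) (z : Y) :
    IsIso (M.act n y z (Fin.last n)) := by
  induction n with
  | zero => exact (inferInstance : IsIso (𝟙 (M.obj (y 0) z)))
  | succ n ih => exact ih fun j => y j.succ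

/-- Between neighbouring indices there is one hom-object; `split` composes it with an inserted
identity, which does nothing by the right unit law. -/
theorem isIso_split_succ (n : ℕ) (y : Fin (n + 1) → Y) (z : Y) (i j : Fin (n + 1)) (h : i ≤ j)
    (hj : (j : ℕ) = i + 1) : IsIso (M.split n y z i j h) := by
  induction n with
  | zero => omega
  | succ n ih =>
    induction j using Fin.cases with
    | zero => exact absurd hj (by simp)
    | succ j =>
      induction i using Fin.cases with
      | zero =>
        obtain rfl : j = 0 := Fin.ext (by simpa using hj)
        have aux : ∀ (A B : Y) (S : W), (A ⟶[W] B) ◁ ((λ_ S).inv ≫ eId W B ▷ S) ≫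
            (α_ _ _ _).inv ≫ eComp W A B B ▷ S = 𝟙 _ := by
          intro A B S
          have h' : (A ⟶[W] B) ◁ ((λ_ S).inv ≫ eId W B ▷ S) ≫ (α_ _ _ _).inv =
              ((ρ_ (A ⟶[W] B)).inv ≫ (A ⟶[W] B) ◁ eId W B) ▷ S := by monoidal
          rw [reassoc_of% h', ← comp_whiskerRight, Category.assoc, e_comp_id W A B,
            id_whiskerRight]
        have e : M.split n (fun j => y j.succ) z 0 0 (Fin.zero_le 0) =
          M.unitIns (fun j => y j.succ) z 0 := M.split_self n _ z 0 _
        have h1 : M.split (n + 1) y z 0 (Fin.succ 0) h = 𝟙 _ :=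
          (congrArg (fun f => (y 0 ⟶[W] y (Fin.succ 0)) ◁ f ≫
            (α_ _ _ _).inv ≫ eComp W (y 0) (y (Fin.succ 0)) (y (Fin.succ 0)) ▷ _) e).trans
            (aux _ _ _)
        rw [h1]
        exact (inferInstance : IsIso (𝟙 (M.seg (n + 1) y z 0)))
      | succ i =>
        exact ih (fun j => y j.succ) i j (Fin.succ_le_succ_iff.1 h) (by simpa using hj)

theorem exists_split_eq (n : ℕ) (y : Fin (n + 1) → Y) (z : Y) (i j : Fin (n + 1)) (h : i ≤ j)
    (hj : i = j) (hy : y i = y j) : ∃ κ : M.seg n y z i ≅ 𝟙_ W ⊗ M.seg n y z j,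
      M.split n y z i j h = κ.hom ≫
        (eId W (y i) ≫ eqToHom (congrArg (fun b => (y i ⟶[W] b)) hy)) ▷ M.seg n y z j := by
  subst hj
  refine ⟨(λ_ _).symm, ?_⟩
  rw [split_self, eqToHom_refl, Category.comp_id]
  rfl

/-- The hom-objects along a tuple. -/
def pathHom {n : ℕ} (y : Fin (n + 1) → Y) (i : Fin n) : W := y i.castSucc ⟶[W] y i.succ

/-- The identities along a tuple. -/
def pathUnit {n : ℕ} (y : Fin (n + 1) → Y) (i : Fin n) (h : y i.castSucc = y i.succ) :
    𝟙_ W ⟶ pathHom (W := W) y i :=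
  eId W (y i.castSucc) ≫ eqToHom (congrArg (fun b => (y i.castSucc ⟶[W] b)) h)

/-- The objects `seg 0` are the terminal vertices of cubes. -/
def segIso : (n : ℕ) → (y : Fin (n + 1) → Y) → (z : Y) →
    (M.seg n y z 0 ≅ cubeObj n (pathHom y) (M.obj (y (Fin.last n)) z) fun _ => false)
  | 0, y, z => Iso.refl (M.obj (y 0) z)
  | n + 1, y, z => whiskerLeftIso (y 0 ⟶[W] y (Fin.succ 0)) (segIso n (fun j => y j.succ) z)

/-- Each step of σ moves by 0 or 1. In the first case `split` inserts an identity, as an edge of the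
cube does; in the second it is invertible. As σ ends at the last index, the final action is
invertible too. So `pull` is, up to isomorphism, the map of the cube from the corner `collapse σ` to
the terminal vertex. -/
theorem exists_iso_pull (d : ℕ) (v : Fin (d + 1) → Y) (z : Y) (n : ℕ)
    (σ : Fin (n + 1) → Fin (d + 1)) (hσ : Monotone σ)
    (hstep : ∀ i : Fin n, (σ i.succ : ℕ) ≤ σ i.castSucc + 1)
    (hlast : σ (Fin.last n) = Fin.last d)
    (hc : ∀ i, collapse σ i = true → v (σ i.castSucc) = v (σ i.succ)) :
    ∃ θ : M.seg d v z (σ 0) ≅ cubeObj n (pathHom fun k => v (σ k))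
        (M.obj (v (σ (Fin.last n))) z) (collapse σ),
      θ.hom ≫ cubeMap n _ _ (fun i => v (σ i.castSucc) = v (σ i.succ))
        (pathUnit fun k => v (σ k)) (collapse σ) (fun _ => false) (fun _ => Bool.false_le _) hc =
      M.pull v z n σ hσ 0 ≫ (M.segIso n (fun k => v (σ k)) z).hom := by
  induction n with
  | zero =>
    have : IsIso (M.act d v z (σ 0)) := by
      rw [show σ 0 = Fin.last d from hlast]
      exact M.isIso_act_last d v z
    exact ⟨@asIso _ _ _ _ (M.act d v z (σ 0)) this, rfl⟩
  | succ n ih =>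
    obtain ⟨θ, hθ⟩ := ih (fun k => σ k.succ) (fun _ _ h => hσ (Fin.succ_le_succ_iff.2 h))
      (fun i => hstep i.succ) hlast (fun i => hc i.succ)
    -- `collapse σ 0` occurs in the type of θ', so it is replaced by a variable b before the case
    -- distinction.
    have aux : ∀ (b : Bool) (_ : collapse σ 0 = b) (hb : b = true → v (σ 0) = v (σ (Fin.succ 0))),
        ∃ θ' : M.seg d v z (σ 0) ≅ sideObj (pathHom (W := W) (fun k => v (σ k)) 0) b ⊗
          cubeObj n (pathHom fun k => v (σ k.succ)) (M.obj (v (σ (Fin.last n).succ)) z)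
            (collapse fun k => σ k.succ),
        θ'.hom ≫ (sideMap b false (Bool.false_le _)
          (fun h => pathUnit (fun k => v (σ k)) 0 (hb h)) ⊗ₘ
          cubeMap n _ _ (fun i => v (σ i.castSucc.succ) = v (σ i.succ.succ))
            (pathUnit fun k => v (σ k.succ)) (collapse fun k => σ k.succ) (fun _ => false)
            (fun _ => Bool.false_le _) (fun i => hc i.succ)) =
        (M.split d v z (σ 0) (σ (Fin.succ 0)) (hσ (Fin.zero_le _)) ≫
          (v (σ 0) ⟶[W] v (σ (Fin.succ 0))) ◁ M.pull v z n (fun k => σ k.succ)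
            (fun _ _ h => hσ (Fin.succ_le_succ_iff.2 h)) 0) ≫
          (v (σ 0) ⟶[W] v (σ (Fin.succ 0))) ◁ (M.segIso n (fun k => v (σ k.succ)) z).hom := by
      intro b hbc hb
      rw [Category.assoc, ← whiskerLeft_comp, ← hθ]
      cases b with
      | true =>
        obtain ⟨κ, hκ⟩ := M.exists_split_eq d v z (σ 0) (σ (Fin.succ 0)) (hσ (Fin.zero_le _))
          (collapse_eq_true.1 hbc) (hb rfl)
        refine ⟨κ ≪≫ whiskerLeftIso (𝟙_ W) θ, ?_⟩
        rw [hκ]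
        change (κ.hom ≫ 𝟙_ W ◁ θ.hom) ≫ (pathUnit (fun k => v (σ k)) 0 (hb rfl) ⊗ₘ _) = _
        rw [Category.assoc, Category.assoc, tensorHom_def', ← whiskerLeft_comp_assoc,
          whisker_exchange]
        rfl
      | false =>
        have h1 : ¬ σ (Fin.castSucc 0) = σ (Fin.succ 0) := of_decide_eq_false hbc
        have h2 : (σ (Fin.succ 0) : ℕ) = σ 0 + 1 := by
          have h3 : (σ 0 : ℕ) ≤ σ (Fin.succ 0) := hσ (Fin.zero_le _)
          have h4 : (σ 0 : ℕ) ≠ σ (Fin.succ 0) := fun h => h1 (Fin.ext h)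
          have h5 : (σ (Fin.succ 0) : ℕ) ≤ σ 0 + 1 := hstep 0
          omega
        have := M.isIso_split_succ d v z (σ 0) (σ (Fin.succ 0)) (hσ (Fin.zero_le _)) h2
        refine ⟨asIso (M.split d v z (σ 0) (σ (Fin.succ 0)) (hσ (Fin.zero_le _))) ≪≫
          whiskerLeftIso (v (σ 0) ⟶[W] v (σ (Fin.succ 0))) θ, ?_⟩
        change (M.split d v z (σ 0) (σ (Fin.succ 0)) (hσ (Fin.zero_le _)) ≫
          (v (σ 0) ⟶[W] v (σ (Fin.succ 0))) ◁ θ.hom) ≫ (𝟙 _ ⊗ₘ _) = _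
        rw [Category.assoc, id_tensorHom, whiskerLeft_comp]
    exact aux _ rfl (hc 0)

end EnrichedBimodule

/-! ### Degeneracies of the bar construction as maps of the cube -/

namespace EnrichedBimodule

section BarMap

variable {W : Type u} [Category.{v} W] [MonoidalCategory W] [SymmetricCategory W]
    {Y : Type w} [EnrichedCategory W Y] (M : EnrichedBimodule W Y)

/-- Nothing precedes index 0, so only an identity is moved around and acts on M. The index is a
variable because σ 0 = 0 holds only propositionally where this is applied. -/
theorem isIso_rmul_of_eq_zero {n : ℕ} (y : Fin (n + 1) → Y) (i : Fin (n + 1)) (hi : i = 0) :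
    IsIso (M.split n y (y 0) 0 i (Fin.zero_le _) ≫ (β_ _ _).hom ≫ M.rmul (y 0) (y i) n y i) := by
  subst hi
  have h := M.rmul_id (y 0) n y 0
  have aux : ∀ (A S : W) (e : 𝟙_ W ⟶ A) (r : S ⊗ A ⟶ S) (_ : S ◁ e ≫ r = (ρ_ S).hom),
      ((λ_ S).inv ≫ e ▷ S) ≫ (β_ _ _).hom ≫ r = 𝟙 S := by
    intro A S e r h
    rw [Category.assoc, BraidedCategory.braiding_naturality_left_assoc, h]
    simp
  have key := (congrArg (· ≫ (β_ _ _).hom ≫ M.rmul (y 0) (y 0) n y 0)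
    (M.split_self n y (y 0) 0 (Fin.zero_le _))).trans (aux _ _ _ _ h)
  rw [key]
  infer_instance

theorem exists_iso_barMap {d : ℕ} (v : Fin (d + 1) → Y) {n : ℕ} (y : Fin (n + 1) → Y)
    (σ : Fin (n + 1) → Fin (d + 1)) (hσ : Monotone σ) (hs : Function.Surjective σ)
    (hy : (fun k => v (σ k)) = y) (hc : ∀ i, collapse σ i = true → y i.castSucc = y i.succ) :
    ∃ θ : M.barObj v ≅ cubeObj n (pathHom y) (M.obj (y (Fin.last n)) (y 0)) (collapse σ),
      θ.hom ≫ cubeMap n _ _ (fun i => y i.castSucc = y i.succ) (pathUnit y) (collapse σ)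
        (fun _ => false) (fun _ => Bool.false_le _) hc =
      (M.barMap v σ hσ ≫ eqToHom (congrArg M.barObj hy)) ≫ (M.segIso n y (y 0)).hom := by
  subst hy
  obtain ⟨θ, hθ⟩ := M.exists_iso_pull d v (v (σ 0)) n σ hσ (step_le_of_surjective hσ hs)
    (map_last_of_surjective hσ hs) hc
  have := M.isIso_rmul_of_eq_zero v (σ 0) (map_zero_of_surjective hσ hs)
  refine ⟨@asIso _ _ _ _ _ this ≪≫ θ, ?_⟩
  rw [eqToHom_refl, Category.comp_id, Iso.trans_hom, Category.assoc, hθ, asIso_hom, barMap]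
  simp only [Category.assoc]

theorem barMap_congr_map {n m : ℕ} (y : Fin (n + 1) → Y) {φ φ' : Fin (m + 1) → Fin (n + 1)}
    (h : φ = φ') (hφ : Monotone φ) (hφ' : Monotone φ') :
    M.barMap y φ hφ ≫ eqToHom (congrArg (fun φ : Fin (m + 1) → Fin (n + 1) =>
      M.barObj fun k => y (φ k)) h) = M.barMap y φ' hφ' := by
  subst h
  simp

/-- A monotone surjection has a monotone section, which yields a retraction by functoriality of
`barMap`. Used to cancel degeneracies in `nonempty_latchingDiagram_iso`. -/
theorem isSplitMono_barMap {d : ℕ} (v : Fin (d + 1) → Y) {n : ℕ}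
    (σ : Fin (n + 1) → Fin (d + 1)) (hσ : Monotone σ) (hs : Function.Surjective σ) :
    IsSplitMono (M.barMap v σ hσ) := by
  have hinv := Function.rightInverse_surjInv hs
  have hmono : Monotone (Function.surjInv hs) := by
    intro i j hij
    by_contra! h
    have hji : j ≤ i := by simpa only [hinv i, hinv j] using hσ h.le
    exact h.ne (congrArg _ (le_antisymm hji hij))
  have h1 := M.barMap_comp v σ hσ (Function.surjInv hs) hmono
  have h2 := M.barMap_congr_map v (funext hinv) (hσ.comp hmono) monotone_id
  exact IsSplitMono.mk' ⟨M.barMap _ (Function.surjInv hs) hmono ≫ eqToHom (congrArg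
      (fun φ : Fin (d + 1) → Fin (d + 1) => M.barObj fun k => v (φ k)) (funext hinv)), by
    rw [reassoc_of% h1]
    exact h2.trans (M.barMap_id v)⟩

variable {n : ℕ} (y : Fin (n + 1) → Y)

/-- The degeneracy from an object of the latching category. -/
def latchingIncl (a : LatchingIndex y) : M.barObj a.vertices ⟶ M.barObj y :=
  M.barMap a.vertices a.degen a.degen.monotone ≫ eqToHom (congrArg M.barObj (funext a.fac))

instance mono_latchingIncl (a : LatchingIndex y) : Mono (M.latchingIncl y a) := by
  have := M.isSplitMono_barMap a.vertices a.degen a.degen.monotone a.surjective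
  exact mono_comp _ _

theorem latchingDiagram_map_incl {a b : LatchingIndex y} (f : a ⟶ b) :
    (M.latchingDiagram y).map f ≫ M.latchingIncl y b = M.latchingIncl y a := by
  have h1 := M.barMap_congr (LatchingIndex.Hom.vertices_eq f) b.degen b.degen.monotone
  have h2 := M.barMap_comp a.vertices (LatchingIndex.Hom.toMap f)
    (LatchingIndex.Hom.toMap f).monotone b.degen b.degen.monotone
  have h3 := M.barMap_congr_map a.vertices (funext (LatchingIndex.Hom.comm f))
    ((LatchingIndex.Hom.toMap f).monotone.comp b.degen.monotone) a.degen.monotone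
  change (M.barMap a.vertices (LatchingIndex.Hom.toMap f) _ ≫ eqToHom _) ≫
    M.barMap b.vertices b.degen _ ≫ eqToHom _ = M.barMap a.vertices a.degen _ ≫ eqToHom _
  rw [Category.assoc, reassoc_of% h1, reassoc_of% h2, ← h3, Category.assoc, eqToHom_trans,
    eqToHom_trans]

end BarMap

end EnrichedBimodule

/-! ### Equivalence of the latching category with the punctured cube -/

namespace LatchingIndex

variable {Y : Type w} {n : ℕ} {y : Fin (n + 1) → Y}

theorem eq_of_collapse (a : LatchingIndex y) (i : Fin n) (h : collapse a.degen i = true) :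
    y i.castSucc = y i.succ := by
  rw [← a.fac, ← a.fac, collapse_eq_true.1 h]

/-- The vertex of the punctured cube corresponding to a degeneracy. -/
def toCube (y : Fin (n + 1) → Y) :
    LatchingIndex y ⥤ PuncturedCube fun i : Fin n => y i.castSucc = y i.succ where
  obj a := ⟨collapse a.degen, exists_collapse a.degen.monotone a.dim_lt, a.eq_of_collapse⟩
  map {a b} f := PuncturedCube.homOfLE fun i hi => collapse_eq_true.2 <| by
    rw [← Hom.comm f, ← Hom.comm f, collapse_eq_true.1 hi]

instance : (toCube y).Faithful where
  map_injective {a b} f g _ := by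
    refine LatchingIndex.Hom.ext (OrderHom.ext _ _ (funext fun k => ?_))
    obtain ⟨k, rfl⟩ := b.surjective k
    exact (Hom.comm f k).trans (Hom.comm g k).symm

/-- The required operator is `a.degen` after a monotone section of `b.degen`. It commutes with the
degeneracies since `a.degen` is constant on the fibres of `b.degen`, by `eq_of_collapse_le`. -/
instance : (toCube y).Full where
  map_surjective {a b} f := by
    have hle : collapse b.degen ≤ collapse a.degen := leOfHom f
    have hinv := Function.rightInverse_surjInv b.surjective
    have hmono : Monotone (Function.surjInv b.surjective) := by
      intro i j hij
      by_contra! h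
      have hji : j ≤ i := by simpa only [hinv i, hinv j] using b.degen.monotone h.le
      exact h.ne (congrArg _ (le_antisymm hji hij))
    refine ⟨(⟨⟨fun k => a.degen (Function.surjInv b.surjective k),
      a.degen.monotone.comp hmono⟩, fun k => ?_⟩ : Hom a b), Subsingleton.elim _ _⟩
    change a.degen (Function.surjInv b.surjective (b.degen k)) = a.degen k
    rcases le_total (Function.surjInv b.surjective (b.degen k)) k with h | h
    · exact eq_of_collapse_le b.degen.monotone hle _ _ h (hinv _)
    · exact (eq_of_collapse_le b.degen.monotone hle _ _ h (hinv _).symm).symm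

instance : (toCube y).EssSurj where
  mem_essImage := by
    rintro ⟨T, hne, hT⟩
    obtain ⟨d, v, σ, hσ, hs, hv, rfl⟩ := exists_degeneracy n y T hT
    exact ⟨⟨d, lt_of_collapse hs hne, v, ⟨σ, hσ⟩, hs, hv⟩, ⟨Iso.refl _⟩⟩

instance : (toCube y).IsEquivalence where

end LatchingIndex

/-! ### The latching object as a colimit over the punctured cube -/

namespace EnrichedBimodule

variable {W : Type u} [Category.{v} W] [MonoidalCategory W] [SymmetricCategory W]
    {Y : Type w} [EnrichedCategory W Y] (M : EnrichedBimodule W Y) {n : ℕ} (y : Fin (n + 1) → Y)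

/-- The isomorphisms θ are chosen separately for each degeneracy. They are natural because they are
compatible with the maps to the terminal vertex, and these maps are monomorphisms. -/
theorem nonempty_latchingDiagram_iso :
    Nonempty (M.latchingDiagram y ≅ LatchingIndex.toCube y ⋙
      cubeFunctor (pathHom y) (M.obj (y (Fin.last n)) (y 0)) (pathUnit y)) := by
  choose θ hθ using fun a : LatchingIndex y => M.exists_iso_barMap a.vertices y a.degen
    a.degen.monotone a.surjective (funext a.fac) a.eq_of_collapse
  -- Up to isomorphisms this map is the degeneracy `latchingIncl`, a monomorphism.
  have hmono : ∀ a : LatchingIndex y, Mono (cubeMap n (pathHom y)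
      (M.obj (y (Fin.last n)) (y 0)) (fun i => y i.castSucc = y i.succ) (pathUnit y)
      (collapse a.degen) (fun _ => false) (fun _ => Bool.false_le _) a.eq_of_collapse) := by
    intro a
    have h : (θ a).inv ≫ M.latchingIncl y a ≫ (M.segIso n y (y 0)).hom = _ :=
      (Iso.inv_comp_eq _).2 (hθ a).symm
    rw [← h]
    infer_instance
  refine ⟨NatIso.ofComponents θ fun {a b} f => ?_⟩
  have h1 := M.latchingDiagram_map_incl y f
  have h2 := cubeMap_comp n (pathHom y) (M.obj (y (Fin.last n)) (y 0))
    (fun i => y i.castSucc = y i.succ) (pathUnit y) (collapse a.degen) (collapse b.degen)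
    (fun _ => false) (leOfHom ((LatchingIndex.toCube y).map f)) (fun _ => Bool.false_le _)
    a.eq_of_collapse b.eq_of_collapse
  have h3 := hmono b
  refine (cancel_mono (cubeMap n (pathHom y) (M.obj (y (Fin.last n)) (y 0))
      (fun i => y i.castSucc = y i.succ) (pathUnit y)
      (collapse b.degen) (fun _ => false) (fun _ => Bool.false_le _) b.eq_of_collapse)).1 ?_
  obtain ⟨g, hg⟩ : ∃ g : M.barObj a.vertices ⟶ M.barObj b.vertices,
    g = (M.latchingDiagram y).map f := ⟨_, rfl⟩
  replace h1 : g ≫ M.latchingIncl y b = M.latchingIncl y a := hg ▸ h1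
  have h4 : g ≫ (θ b).hom ≫ cubeMap n (pathHom y)
      (M.obj (y (Fin.last n)) (y 0)) (fun i => y i.castSucc = y i.succ) (pathUnit y)
      (collapse b.degen) (fun _ => false) (fun _ => Bool.false_le _) b.eq_of_collapse =
      (θ a).hom ≫ cubeMap n (pathHom y)
      (M.obj (y (Fin.last n)) (y 0)) (fun i => y i.castSucc = y i.succ) (pathUnit y)
      (collapse a.degen) (fun _ => false) (fun _ => Bool.false_le _) a.eq_of_collapse := by
    rw [hθ, hθ]
    exact (Category.assoc _ _ _).symm.trans (congrArg (· ≫ _) h1)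
  rw [← hg]
  exact (Category.assoc _ _ _).trans (h4.trans ((congrArg ((θ a).hom ≫ ·) h2.symm).trans
    (Category.assoc _ _ _).symm))

theorem nonempty_latchingObj_iso [HasColimits W] {c : Cocone (cubeFunctor (pathHom y)
    (M.obj (y (Fin.last n)) (y 0)) (pathUnit y))} (hc : IsColimit c) :
    Nonempty (M.latchingObj y ≅ c.pt) := by
  obtain ⟨i⟩ := M.nonempty_latchingDiagram_iso y
  have hc' : IsColimit (c.whisker (LatchingIndex.toCube y)) :=
    hc.whiskerEquivalence (LatchingIndex.toCube y).asEquivalence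
  have : HasColimitsOfSize.{0, 0} W := hasColimitsOfSizeShrink.{0, 0, v, v} W
  have : HasColimitsOfShape (LatchingIndex y) W :=
    hasColimitsOfShape_of_essentiallySmall.{0} _ _
  exact ⟨(colimit.isColimit _).coconePointsIsoOfNatIso hc' i⟩

end EnrichedBimodule

/-! ### The product formula for weights -/

section Weight

variable {V : Type u₁} [Category.{v₁} V] [SemiCartesianMonoidalCategory V]
    {W : Type u} [Category.{v} W] [HasColimits W] [ModelCategory W]
    [MonoidalCategory W] [SymmetricCategory W] [MonoidalClosed W]
    [SymmetricMonoidalModelCategory W]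
    {k : Type w₁} [Ring k] (χ : MultiplicativeEulerCharacteristic W k)
    (S : V ⥤ W) [S.Monoidal] {X : Type w} [EnrichedCategory V X]

/-- The weight of a tuple is a product of entries of `Z - 1`. -/
theorem wgt_eq_cubeWeight (hS : ∀ A : V, χ.IsFinite (S.obj A))
    (hcof : IsCofibrantEnriched W (TransportEnrichment S X)) {n : ℕ} (x : Fin (n + 1) → X) :
    wgt S χ x = cubeWeight 1 n
      (fun i => zetaMatrix (fun A : V => χ.val (S.obj A)) X (x i.castSucc) (x i.succ))
      (fun i => x i.castSucc = x i.succ) := by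
  let M := unitBimodule S X
  let y : Fin (n + 1) → TransportEnrichment S X := x
  -- As S is strong monoidal, the coefficient object S(𝟙) is cofibrant with Euler characteristic 1
  -- and contributes the factor 1.
  have e : 𝟙_ W ≅ S.obj (𝟙_ V) := Functor.Monoidal.εIso S
  have hI : IsCofibrant (𝟙_ W) := SymmetricMonoidalModelCategory.unit_cofibrant
  have he : ∀ (a b : TransportEnrichment S X) (h : a = b),
      Cofibration (eId W a ≫ eqToHom (congrArg (fun b => (a ⟶[W] b)) h)) := fun a b h => by
    subst h
    rw [eqToHom_refl, Category.comp_id]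
    exact hcof.id a
  obtain ⟨c, hc, -, -, -, -, hfin, hfin', hval⟩ := exists_isColimit_cubeFunctor χ (S.obj (𝟙_ V))
    (isCofibrant_of_iso e) (hS _) n (EnrichedBimodule.pathHom y)
    (fun i => y i.castSucc = y i.succ) (EnrichedBimodule.pathUnit y)
    (fun i => hcof.hom _ _) (fun i => hS _) (fun i h => he _ _ h)
  obtain ⟨i⟩ := M.nonempty_latchingObj_iso y hc
  have j := M.segIso n y (y 0)
  have h1 : χ.val (M.barObj y) = _ := χ.val_eq_of_iso j ((χ.isFinite_iff_of_iso j).2 hfin')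
  have h2 : χ.val (M.latchingObj y) = _ := χ.val_eq_of_iso i ((χ.isFinite_iff_of_iso i).2 hfin)
  have h3 : χ.val (S.obj (𝟙_ V)) = 1 := by
    rw [← χ.val_eq_of_iso e χ.isFinite_unit, χ.val_unit]
  rw [h3] at hval
  exact (congrArg₂ (· - ·) h1 h2).trans hval

end Weight

end MagnitudeHomology

theorem mainTheorem1
    {V : Type u₁} [Category.{v₁} V] [SemiCartesianMonoidalCategory V]
    {W : Type u} [Category.{v} W] [HasColimits W] [ModelCategory W]
    [MonoidalCategory W] [SymmetricCategory W] [MonoidalClosed W]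
    [SymmetricMonoidalModelCategory W]
    [SimplicialCategory W] [SimplicialModelCategory W]
    {k : Type w₁} [Ring k] [TopologicalSpace k] [IsTopologicalRing k] [T2Space k]
    (χ : MultiplicativeEulerCharacteristic W k)
    (S : V ⥤ W) [S.Monoidal] (hS : ∀ A : V, χ.IsFinite (S.obj A))
    {X : Type w} [EnrichedCategory V X] [Fintype X] [DecidableEq X]
    (hcof : IsCofibrantEnriched W (TransportEnrichment S X))
    (hX : HasConvergentMagnitudeEulerCharacteristic S χ X) :
    ∃ h : HasMobiusInversion (fun A : V => χ.val (S.obj A)) X,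
      magnitude (fun A : V => χ.val (S.obj A)) X h = χ.val (realizedMagnitudeNerve S X) := by
  -- This turns condition (ii) into entrywise convergence of the Neumann series of Z.
  have hpath : ∀ (n : ℕ) (a b : X),
      ∑ x : Fin (n + 1) → X with x 0 = a ∧ x (Fin.last n) = b, wgt S χ x =
        ((zetaMatrix (fun A : V => χ.val (S.obj A)) X - 1) ^ n) a b := fun n a b =>
    (Finset.sum_congr rfl fun x _ => wgt_eq_cubeWeight χ S hS hcof x).trans
      (sum_cubeWeight _ n a b)
  -- Each tuple is counted once, by its pair of endpoints.
  have htot : ∀ n : ℕ, ∑ x : Fin (n + 1) → X, wgt S χ x =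
      ∑ a, ∑ b, ((zetaMatrix (fun A : V => χ.val (S.obj A)) X - 1) ^ n) a b := fun n => by
    simp only [← hpath, Finset.sum_filter, ite_and]
    rw [Finset.sum_congr rfl fun a _ => Finset.sum_comm, Finset.sum_comm]
    simp
  refine isUnit_and_sum_inverse (fun a b => ?_) ?_
  · simpa only [hpath] using hX.converges a b
  · simpa only [htot] using hX.tendsto_val
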